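/- **Setting.** Let $N$ qubits have collective spin component $J_z=\tfrac12\sum_{i=1}^N\sigma_z^{(i)}$. For a decay function $\chi(t)\ge 0$ and an arbitrary (pure or mixed) input state $\rho_0$, uncontrolled classical collective dephasing during an interrogation time $t$ with signal frequency $b\in\mathbb R$ produces $$\rho_b(t)=\mathbb E_{\lambda}\big[e^{-i(bt+\lambda)J_z}\,\rho_0\,e^{i(bt+\lambda)J_z}\big],\qquad \lambda\sim\mathcal N(0,\,c\,\chi(t)),$$ where the normalization is either $c=1$ (so that $\chi(t)=\langle\lambda(t)^2\rangle$) or $c=2$ (so that coherences between $J_z$-eigenvalues $m,m'$ decay as $e^{-\chi(t)(m-m')^2}$); everything below holds for both. Let $$F_Q[\rho_b]=2\sum_{\lambda_i+\lambda_j>0}\frac{|\langle i|\partial_b\rho_b|j\rangle|^2}{\lambda_i+\lambda_j}$$ be the quantum Fisher information (QFI), where $\rho_b=\sum_i\lambda_i|i\rangle\langle i|$ is an eigendecomposition, and let $\Delta^2_{\rho}J_z$ be the variance of $J_z$ in $\rho$. For a total time $T>0$, let $F_{Q\,\rm tot}(N,T)=\sup_{\rho_0,\,t>0}\frac Tt F_Q[\rho_b(t)]$.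 The *precision* $\Delta\hat b^2$ at $b$ with total time $T$ is bounded below by $B$, written $\Delta \hat b^2\ge B$, if (i) $\frac{t}{T F_Q[\rho_b(t)]}\ge B$ for every $\rho_0$ and every $t>0$ (the quotient being $+\infty$ if $F_Q=0$), and (ii) for every protocol in which $\rho_0$ is prepared, evolves for a time $t>0$ and is measured with a finite-outcome POVM, in $\nu$ independent repetitions with $\nu t=T$, every estimator $\hat b$ computed from the $\nu$ outcomes that is locally unbiased at $b$ (its expectation $E(b')$ at parameter $b'$ satisfies $E(b)=b$ and $E'(b)=1$) has variance at least $B$ at $b$. **1. Single-shot bound.** For every $N$, $\rho_0$, $t\ge 0$ and $b$, $\rho_b(t)$ is a density matrix, differentiable in $b$, and $$F_Q[\rho_b(t)]\le\frac{4t^2\,\Delta^2_{\rho_b(t)}J_z}{1+4\chi(t)\,\Delta^2_{\rho_b(t)}J_z}\le\frac{N^2t^2}{1+\chi(t)N^2}.$$ **2. Total QFI.** For every $N$, $T>0$ and $b$, $F_{Q\,\rm tot}(N,T)\le T\sup_{t>0}\dfrac{N^2t}{1+\chi(t)N^2}$ (both sides in $[0,\infty]$). **3. Markovian noise.** Let $\chi(t)=\chi_0\omega_c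 t$ for all $t>0$, with $\chi_0,\omega_c>0$, and let $N\ge1$. Then $t\mapsto\frac{N^2t}{1+\chi(t)N^2}$ is strictly increasing on $(0,\infty)$, with supremum and limit at infinity $\frac1{\chi_0\omega_c}$; for all $T>0$ and $b$, $F_{Q\,\rm tot}(N,T)\le\frac{T}{\chi_0\omega_c}$ and $\Delta\hat b^2\ge\frac{\chi_0\omega_c}{T}$. **4. Colored noise.** Let $\chi(t)=\chi_0^n(\omega_ct)^n$ for all $t>0$, with real $n>1$ and $\chi_0,\omega_c>0$, and let $N\ge1$. Then $t\mapsto\frac{N^2t}{1+\chi(t)N^2}$ is differentiable on $(0,\infty)$, has there the unique stationary point $$t^\star=\frac1{\chi_0\omega_c}\Big(\frac1{n-1}\Big)^{1/n}N^{-2/n},$$ and attains its maximum over $(0,\infty)$ there, with value $\frac{1}{\chi_0\omega_c}\frac{(n-1)^{1-1/n}}{n}N^{2-2/n}$; for all $T>0$ and $b$, $$F_{Q\,\rm tot}(N,T)\le\frac{T}{\chi_0\omega_c}\frac{(n-1)^{1-1/n}}{n}N^{2-2/n},\qquad \Delta\hat b^2\ge\frac{\chi_0\omega_c}{T}\,g(n)\,N^{-2(n-1)/n},\quad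 g(n)=n(n-1)^{-1+1/n}.$$ **5. Power law at short times only.** Let $n\ge1$ be real, $\chi_0,\omega_c>0$, and suppose only that $\chi(t)/\big(\chi_0^n(\omega_ct)^n\big)\to1$ as $t\to0^+$. Then for every $\varepsilon\in(0,1)$ there is $\tau>0$ such that for all $N\ge1$, $T>0$ and $b$, with interrogation times restricted to $0<t\le\tau$, $\Delta\hat b^2\ge(1-\varepsilon)B$, where $B=\frac{\chi_0\omega_c}{T}$ if $n=1$ and $B=\frac{\chi_0\omega_c}{T}g(n)N^{-2(n-1)/n}$ if $n>1$. -/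

import Mathlib

open scoped NNReal ENNReal Matrix Topology ComplexOrder

noncomputable section

namespace CollectiveDephasing

/-- Computational-basis labels of `N` qubits; the Hilbert space is `ℂ ^ (Reg N)`. -/
abbrev Reg (N : ℕ) : Type := Fin N → Fin 2

/-- Operators on the Hilbert space of `N` qubits. -/
abbrev Op (N : ℕ) : Type := Matrix (Reg N) (Reg N) ℂ

/-- The Pauli matrix `σ_z`. -/
def pauliZ : Matrix (Fin 2) (Fin 2) ℂ := !![1, 0; 0, -1]

/-- The one-qubit operator `A` acting on qubit `i`, tensored with the identity elsewhere. -/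
def onQubit {N : ℕ} (i : Fin N) (A : Matrix (Fin 2) (Fin 2) ℂ) : Op N :=
  Matrix.of fun s s' => if ∀ j, j ≠ i → s j = s' j then A (s i) (s' i) else 0

/-- The collective spin component `J_z = ½ ∑ᵢ σ_z⁽ⁱ⁾`. -/
def Jz (N : ℕ) : Op N := (1 / 2 : ℂ) • ∑ i : Fin N, onQubit i pauliZ

/-- The collective rotation `e^{-iθ J_z}`. -/
def rot (N : ℕ) (θ : ℝ) : Op N := NormedSpace.exp ((-(Complex.I * (θ : ℂ))) • Jz N)

/-- Density matrices, pure or mixed. -/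
def IsDensity {N : ℕ} (ρ : Op N) : Prop := ρ.PosSemidef ∧ ρ.trace = 1

/-- The ensemble-averaged state `𝔼[e^{-i(bt+ℓ) J_z} ρ₀ e^{i(bt+ℓ) J_z}]` after interrogation
time `t`, where `ℓ` is the accumulated random phase, Gaussian with mean `0` and variance `v`
(the average is taken entry by entry). -/
def outputState {N : ℕ} (ρ₀ : Op N) (v : ℝ≥0) (t b : ℝ) : Op N :=
  Matrix.of fun s s' =>
    ∫ ℓ : ℝ, (rot N (b * t + ℓ) * ρ₀ * (rot N (b * t + ℓ))ᴴ) s s'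
      ∂(ProbabilityTheory.gaussianReal 0 v)

/-- The variance `⟨A²⟩ - ⟨A⟩²` of the observable `A` in the state `ρ`. -/
def variance {N : ℕ} (ρ A : Op N) : ℝ :=
  ((ρ * (A * A)).trace).re - (((ρ * A).trace).re) ^ 2

/-- The entrywise derivative `∂_b ρ_b`. -/
def paramDeriv {N : ℕ} (ρ : ℝ → Op N) (b : ℝ) : Op N :=
  Matrix.of fun s s' => deriv (fun x => ρ x s s') b

open Classical in
/-- The quantum Fisher information `2 ∑_{λᵢ+λⱼ>0} |⟨i|∂_b ρ_b|j⟩|² / (λᵢ+λⱼ)`, where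
`ρ_b = ∑ᵢ λᵢ |i⟩⟨i|` is an eigendecomposition. (Value `0` if `ρ_b` is not Hermitian.) -/
def qfi {N : ℕ} (ρ : ℝ → Op N) (b : ℝ) : ℝ :=
  if h : (ρ b).IsHermitian then
    2 * ∑ i, ∑ j,
      if 0 < h.eigenvalues i + h.eigenvalues j then
        ‖((h.eigenvectorUnitary : Op N)ᴴ * paramDeriv ρ b * (h.eigenvectorUnitary : Op N)) i j‖ ^ 2
          / (h.eigenvalues i + h.eigenvalues j)
      else 0
  else 0

/-- The total quantum Fisher information `ν F_Q` with `ν = T / t`, optimized over all input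
states and over all interrogation times `t ∈ S`. The phase variance at time `t` is `v t`. -/
def totalQFI (N : ℕ) (v : ℝ → ℝ≥0) (S : Set ℝ) (T b : ℝ) : ℝ≥0∞ :=
  ⨆ (ρ₀ : Op N) (_ : IsDensity ρ₀) (t : ℝ) (_ : t ∈ S),
    ENNReal.ofReal (T / t * qfi (outputState ρ₀ (v t) t) b)

/-- The quantum Cramér–Rao value `t / (T F_Q)`, optimized over all input states and over all
interrogation times `t ∈ S`; it is `∞` where `F_Q = 0`. -/
def qcrbPrecision (N : ℕ) (v : ℝ → ℝ≥0) (S : Set ℝ) (T b : ℝ) : ℝ≥0∞ :=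
  ⨅ (ρ₀ : Op N) (_ : IsDensity ρ₀) (t : ℝ) (_ : t ∈ S),
    ENNReal.ofReal t / ENNReal.ofReal (T * qfi (outputState ρ₀ (v t) t) b)

/-- An estimation protocol: an input state, an interrogation time, a number of repetitions, a
measurement (a POVM) performed in each repetition, and an estimate computed from the recorded
string of outcomes. -/
structure Protocol (N : ℕ) where
  input : Op N
  input_density : IsDensity input
  time : ℝ
  time_pos : 0 < time
  shots : ℕ
  outcomes : ℕ
  povm : Fin outcomes → Op N
  povm_pos : ∀ a, (povm a).PosSemidef
  povm_sum : ∑ a, povm a = 1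
  estimate : (Fin shots → Fin outcomes) → ℝ

namespace Protocol

variable {N : ℕ} (P : Protocol N)

/-- The total runtime `ν t`. -/
def runtime : ℝ := P.shots * P.time

/-- The probability of the string of outcomes `μ` in independent repetitions, at parameter `b`. -/
def prob (v : ℝ → ℝ≥0) (b : ℝ) (μ : Fin P.shots → Fin P.outcomes) : ℝ :=
  ∏ k, ((outputState P.input (v P.time) P.time b * P.povm (μ k)).trace).re

/-- The expectation of the estimate at parameter `b`. -/
def mean (v : ℝ → ℝ≥0) (b : ℝ) : ℝ := ∑ μ, P.prob v b μ * P.estimate μ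

/-- The variance `Δb̂²` of the estimate at parameter `b`. -/
def errorSq (v : ℝ → ℝ≥0) (b : ℝ) : ℝ :=
  ∑ μ, P.prob v b μ * (P.estimate μ - P.mean v b) ^ 2

/-- Unbiasedness at `b`, to first order. (The mean is a trigonometric polynomial in the
parameter, so it cannot coincide with the parameter on a whole interval.) -/
def IsLocallyUnbiased (v : ℝ → ℝ≥0) (b : ℝ) : Prop :=
  P.mean v b = b ∧ HasDerivAt (P.mean v) 1 b

end Protocol

/-- `g(n) = n (n-1)^{-1+1/n}`. -/
def gFactor (n : ℝ) : ℝ := n * (n - 1) ^ (-1 + 1 / n)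

/-- The state-independent lower bound on `Δb̂²` for the power law `χ(t) = χ₀ⁿ (ω t)ⁿ`. -/
def precisionBound (χ₀ ω n T : ℝ) (N : ℕ) : ℝ :=
  if n = 1 then χ₀ * ω / T
  else χ₀ * ω / T * gFactor n * (N : ℝ) ^ (-(2 * (n - 1) / n))

/-- The optimal interrogation time for `n > 1`. -/
def tStar (χ₀ ω n : ℝ) (N : ℕ) : ℝ :=
  1 / (χ₀ * ω) * (1 / (n - 1)) ^ (1 / n) * (N : ℝ) ^ (-(2 / n))

/-- The quantity `N² t / (1 + χ(t) N²)` to be maximized over `t`. -/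
def rateBound (χ : ℝ → ℝ) (N : ℕ) (t : ℝ) : ℝ :=
  (N : ℝ) ^ 2 * t / (1 + χ t * (N : ℝ) ^ 2)

/-- Every way of quantifying the precision that is attainable with total runtime `T` and
interrogation times in `S` is at least `B`: the quantum Cramér–Rao value of every input state,
and the variance of every (locally) unbiased estimator. -/
def PrecisionAtLeast (N : ℕ) (v : ℝ → ℝ≥0) (S : Set ℝ) (T b B : ℝ) : Prop :=
  ENNReal.ofReal B ≤ qcrbPrecision N v S T b ∧
  ∀ P : Protocol N, P.time ∈ S → P.runtime = T → P.IsLocallyUnbiased v b → B ≤ P.errorSq v b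

end CollectiveDephasing

end

/-! The parameter enters the output state in two interchangeable ways: as a rotation of each state
in the mixture, generated by `J_z`, and as a shift of the Gaussian law of the angle. Assigning the
whole derivative to the rotation gives the bound `4 t² V`, with `V` the variance of `J_z`; assigning
it to the shift gives the Fisher information `t² / v` of the Gaussian. Splitting it with weights `β`
and `γ v`, `γ v + β = 1`, costs `t² (γ² v + 4 β² V)`, and the best split adds the two bounds
harmonically: `4 t² V / (1 + 4 v V)`.

`variational_bound` makes this precise without logarithmic derivatives: for every Hermitian `X` it
bounds `2 Tr(ρ' X) - Tr(ρ X²)` by averaging the positivity of `(X - K)(X - K)ᴴ` over the angle. The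
shift part of `K` is converted by Gaussian integration by parts (`integral_mul_rotatedState`), the
rotation part by cyclicity of the trace (`trace_generator_mul`).

The same inequality is used twice. With `X` the symmetric logarithmic derivative it bounds the
quantum Fisher information (`exists_qfi_eq`). With `X` the score-weighted sum of POVM elements it
bounds the Fisher information of any measurement directly (`Protocol.fisher_le`), and the classical
Cramér–Rao inequality for independent repetitions then covers every locally unbiased estimator.

What remains is calculus: `V ≤ N² / 4` turns the bound into `t * rateBound`, and maximizing the rate
over `t` reduces, for a power law, to Bernoulli's inequality. The normalization `c ≥ 1` enters only
through monotonicity: more phase variance lowers the bound. -/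

open ProbabilityTheory MeasureTheory

namespace CollectiveDephasing

variable {N : ℕ}

/-! ### The collective spin in the computational basis -/

/-- The eigenvalue of `J_z` on a computational basis state. -/
noncomputable def spinValue (s : Reg N) : ℝ := 1 / 2 * ∑ i, if s i = 0 then 1 else -1

lemma abs_spinValue_le (s : Reg N) : |spinValue s| ≤ N / 2 := by
  have h : |∑ i, if s i = 0 then (1 : ℝ) else -1| ≤ N := by
    refine (Finset.abs_sum_le_sum_abs _ _).trans ?_
    refine (Finset.sum_le_sum (g := fun _ => (1 : ℝ)) fun i _ => ?_).trans (by simp)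
    split_ifs <;> simp
  rw [spinValue, abs_mul, abs_of_pos (by norm_num : (0 : ℝ) < 1 / 2)]
  linarith

lemma onQubit_pauliZ (i : Fin N) :
    onQubit i pauliZ = Matrix.diagonal fun s : Reg N => if s i = 0 then (1 : ℂ) else -1 := by
  ext s s'
  rw [onQubit, Matrix.of_apply, Matrix.diagonal_apply]
  by_cases hs : s = s'
  · subst hs
    rw [if_pos rfl, if_pos fun _ _ => rfl]
    generalize s i = a
    fin_cases a <;> simp [pauliZ]
  · rw [if_neg hs]
    split_ifs with h
    · have hi : s i ≠ s' i := fun hi => hs <| funext fun j => by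
        by_cases hj : j = i
        · rw [hj, hi]
        · exact h j hj
      rcases Fin.exists_fin_two.mp ⟨s i, rfl⟩ with h1 | h1 <;>
      rcases Fin.exists_fin_two.mp ⟨s' i, rfl⟩ with h2 | h2 <;>
      simp_all [pauliZ]
    · rfl

lemma Jz_eq_diagonal : Jz N = Matrix.diagonal fun s => (spinValue s : ℂ) := by
  have h : ∑ i : Fin N, onQubit i pauliZ
      = Matrix.diagonal fun s : Reg N => ∑ i, if s i = 0 then (1 : ℂ) else -1 := by
    ext s s'
    simp only [onQubit_pauliZ, Matrix.sum_apply, Matrix.diagonal_apply]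
    split_ifs <;> simp
  rw [Jz, h, ← Matrix.diagonal_smul]
  congr 1
  funext s
  simp only [Pi.smul_apply, smul_eq_mul, spinValue]
  push_cast
  congr 1
  refine Finset.sum_congr rfl fun i _ => ?_
  split_ifs <;> simp

lemma Jz_isHermitian : (Jz N).IsHermitian := by
  rw [Jz_eq_diagonal, Matrix.isHermitian_diagonal_iff]
  intro s
  simp [isSelfAdjoint_iff]

lemma rot_eq_diagonal (θ : ℝ) :
    rot N θ = Matrix.diagonal fun s => Complex.exp (-(Complex.I * θ) * spinValue s) := by
  rw [rot, Jz_eq_diagonal, ← Matrix.diagonal_smul, Matrix.exp_diagonal]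
  congr 1
  funext s
  rw [Pi.coe_exp, ← Complex.exp_eq_exp_ℂ]
  rfl

/-- The input state rotated by the angle `θ`. -/
noncomputable def rotatedState (ρ₀ : Op N) (θ : ℝ) : Op N := rot N θ * ρ₀ * (rot N θ)ᴴ

lemma rotatedState_apply (ρ₀ : Op N) (θ : ℝ) (s s' : Reg N) :
    rotatedState ρ₀ θ s s'
      = ρ₀ s s' * Complex.exp (-(Complex.I * θ) * (spinValue s - spinValue s')) := by
  rw [rotatedState, rot_eq_diagonal, Matrix.diagonal_conjTranspose, Matrix.mul_diagonal,
    Matrix.diagonal_mul, Pi.star_apply, Complex.star_def, ← Complex.exp_conj]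
  rw [mul_sub, sub_eq_add_neg, Complex.exp_add]
  simp only [map_mul, map_neg, Complex.conj_I, Complex.conj_ofReal]
  ring_nf

lemma rotatedState_posSemidef {ρ₀ : Op N} (h : IsDensity ρ₀) (θ : ℝ) :
    (rotatedState ρ₀ θ).PosSemidef :=
  h.1.mul_mul_conjTranspose_same _

lemma rotatedState_trace {ρ₀ : Op N} (h : IsDensity ρ₀) (θ : ℝ) :
    (rotatedState ρ₀ θ).trace = 1 := by
  rw [← h.2]
  exact Finset.sum_congr rfl fun s _ => by simp [rotatedState_apply]

/-! ### Gaussian averages -/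

lemma norm_exp_phase (x d : ℝ) : ‖Complex.exp (-(Complex.I * x) * d)‖ = 1 := by
  rw [Complex.norm_exp]
  simp

lemma continuous_rotatedState (ρ₀ : Op N) (θ : ℝ) (s s' : Reg N) :
    Continuous fun ℓ : ℝ => rotatedState ρ₀ (θ + ℓ) s s' := by
  simp only [rotatedState_apply]
  fun_prop

lemma norm_rotatedState (ρ₀ : Op N) (θ : ℝ) (s s' : Reg N) :
    ‖rotatedState ρ₀ θ s s'‖ = ‖ρ₀ s s'‖ := by
  rw [rotatedState_apply, norm_mul, ← Complex.ofReal_sub, norm_exp_phase, mul_one]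

lemma integrable_rotatedState (ρ₀ : Op N) (v : ℝ≥0) (θ : ℝ) (s s' : Reg N) :
    Integrable (fun ℓ : ℝ => rotatedState ρ₀ (θ + ℓ) s s') (gaussianReal 0 v) :=
  Integrable.of_bound (continuous_rotatedState ρ₀ θ s s').aestronglyMeasurable ‖ρ₀ s s'‖
    (.of_forall fun ℓ => (norm_rotatedState ρ₀ (θ + ℓ) s s').le)

lemma integrable_id_gaussianReal (v : ℝ≥0) :
    Integrable (fun ℓ : ℝ => (ℓ : ℂ)) (gaussianReal 0 v) :=
  ((memLp_id_gaussianReal 1).integrable (by simp)).ofReal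

lemma integrable_sq_gaussianReal (v : ℝ≥0) :
    Integrable (fun ℓ : ℝ => ℓ ^ 2) (gaussianReal 0 v) := by
  have h := (memLp_id_gaussianReal (μ := 0) (v := v) 2).integrable_sq
  simpa using h

lemma integral_sq_gaussianReal (v : ℝ≥0) : ∫ ℓ : ℝ, ℓ ^ 2 ∂(gaussianReal 0 v) = v := by
  have h := variance_id_gaussianReal (μ := 0) (v := v)
  rw [variance_eq_sub (memLp_id_gaussianReal 2)] at h
  simpa using h

lemma integrable_mul_rotatedState (ρ₀ : Op N) (v : ℝ≥0) (θ : ℝ) (s s' : Reg N) :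
    Integrable (fun ℓ : ℝ => (ℓ : ℂ) * rotatedState ρ₀ (θ + ℓ) s s') (gaussianReal 0 v) := by
  have h := (integrable_id_gaussianReal v).bdd_mul
    (continuous_rotatedState ρ₀ θ s s').aestronglyMeasurable
    (.of_forall fun ℓ => (norm_rotatedState ρ₀ (θ + ℓ) s s').le)
  exact h.congr (.of_forall fun ℓ => mul_comm _ _)

lemma integral_exp_gaussianReal (v : ℝ≥0) (z : ℂ) :
    ∫ ℓ : ℝ, Complex.exp (z * ℓ) ∂(gaussianReal 0 v) = Complex.exp (v * z ^ 2 / 2) := by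
  have h := complexMGF_id_gaussianReal (μ := 0) (v := v) z
  simpa [complexMGF] using h

/-- Derivative in `z` of the moment generating function, computed once under the integral and once
from the closed form. This is Gaussian integration by parts for exponentials. -/
lemma integral_mul_exp_gaussianReal (v : ℝ≥0) (z : ℂ) :
    ∫ ℓ : ℝ, (ℓ : ℂ) * Complex.exp (z * ℓ) ∂(gaussianReal 0 v)
      = v * z * Complex.exp (v * z ^ 2 / 2) := by
  have h1 := hasDerivAt_complexMGF (X := id) (μ := gaussianReal 0 v) (z := z)
    (by simp [integrableExpSet_id_gaussianReal])
  have h2 : HasDerivAt (complexMGF id (gaussianReal 0 v))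
      (Complex.exp (v * z ^ 2 / 2) * (v * z)) z := by
    have h3 : complexMGF id (gaussianReal 0 v) = fun z : ℂ => Complex.exp (v * z ^ 2 / 2) := by
      funext z
      simp [complexMGF_id_gaussianReal]
    rw [h3]
    refine HasDerivAt.cexp ?_
    have h4 := (((hasDerivAt_id z).pow 2).const_mul (v : ℂ)).div_const 2
    refine h4.congr_deriv ?_
    simp
    ring
  have h5 := h1.unique h2
  simp only [id] at h5
  rw [h5]
  ring

/-! ### The output state -/

lemma outputState_apply (ρ₀ : Op N) (v : ℝ≥0) (t b : ℝ) (s s' : Reg N) :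
    outputState ρ₀ v t b s s'
      = ∫ ℓ : ℝ, rotatedState ρ₀ (b * t + ℓ) s s' ∂(gaussianReal 0 v) := rfl

lemma rotatedState_add_apply (ρ₀ : Op N) (θ ℓ : ℝ) (s s' : Reg N) :
    rotatedState ρ₀ (θ + ℓ) s s' = rotatedState ρ₀ θ s s' *
      Complex.exp (-(Complex.I * (spinValue s - spinValue s')) * ℓ) := by
  rw [rotatedState_apply, rotatedState_apply, mul_assoc, ← Complex.exp_add]
  congr 2
  push_cast
  ring

/-- The Gaussian factor is `exp(-v (m - m')² / 2)` for the spin values `m`, `m'`, so variance `2χ`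
gives the decay `exp(-χ (m - m')²)`. -/
lemma outputState_eq (ρ₀ : Op N) (v : ℝ≥0) (t b : ℝ) (s s' : Reg N) :
    outputState ρ₀ v t b s s' = rotatedState ρ₀ (b * t) s s' *
      Complex.exp (v * (-(Complex.I * (spinValue s - spinValue s'))) ^ 2 / 2) := by
  rw [outputState_apply]
  simp only [rotatedState_add_apply]
  rw [integral_const_mul, integral_exp_gaussianReal]

/-- The generator `-i [J_z, ρ]` of the rotation about the `z` axis. -/
noncomputable def generator (ρ : Op N) : Op N := -Complex.I • (Jz N * ρ - ρ * Jz N)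

lemma generator_apply (ρ : Op N) (s s' : Reg N) :
    generator ρ s s' = -(Complex.I * (spinValue s - spinValue s')) * ρ s s' := by
  simp only [generator, Jz_eq_diagonal, Matrix.smul_apply, Matrix.sub_apply,
    Matrix.diagonal_mul, Matrix.mul_diagonal, smul_eq_mul]
  ring

lemma hasDerivAt_outputState (ρ₀ : Op N) (v : ℝ≥0) (t b : ℝ) (s s' : Reg N) :
    HasDerivAt (fun x => outputState ρ₀ v t x s s')
      (t * generator (outputState ρ₀ v t b) s s') b := by
  simp only [outputState_eq, generator_apply, rotatedState_apply]
  have h1 : HasDerivAt (fun x : ℝ => -(Complex.I * ((x * t : ℝ) : ℂ)) *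
      ((spinValue s : ℂ) - spinValue s'))
      (-(Complex.I * t) * ((spinValue s : ℂ) - spinValue s')) b := by
    have h2 := (((hasDerivAt_id b).mul_const t).ofReal_comp.const_mul Complex.I).neg.mul_const
      ((spinValue s : ℂ) - spinValue s')
    simpa using h2
  refine ((h1.cexp.const_mul (ρ₀ s s')).mul_const _).congr_deriv ?_
  ring

lemma paramDeriv_outputState (ρ₀ : Op N) (v : ℝ≥0) (t b : ℝ) :
    paramDeriv (outputState ρ₀ v t) b = (t : ℂ) • generator (outputState ρ₀ v t b) := by
  ext s s'
  exact (hasDerivAt_outputState ρ₀ v t b s s').deriv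

/-- Integration by parts trades the weight `ℓ` for `v` times a derivative in the angle, and that
derivative is the generator. It identifies the shift of the Gaussian with the rotation of the state.
-/
lemma integral_mul_rotatedState (ρ₀ : Op N) (v : ℝ≥0) (t b : ℝ) (s s' : Reg N) :
    ∫ ℓ : ℝ, (ℓ : ℂ) * rotatedState ρ₀ (b * t + ℓ) s s' ∂(gaussianReal 0 v)
      = v * generator (outputState ρ₀ v t b) s s' := by
  rw [generator_apply, outputState_eq, mul_left_comm _ (rotatedState ρ₀ (b * t) s s'),
    mul_left_comm _ (rotatedState ρ₀ (b * t) s s'), ← mul_assoc (v : ℂ),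
    ← integral_mul_exp_gaussianReal, ← integral_const_mul]
  refine integral_congr_ae (.of_forall fun ℓ => ?_)
  beta_reduce
  rw [rotatedState_add_apply, mul_left_comm]

lemma trace_mul_eq_sum (A B : Op N) : (A * B).trace = ∑ s, ∑ s', A s s' * B s' s := by
  simp only [Matrix.trace, Matrix.diag, Matrix.mul_apply]

lemma integrable_trace (ρ₀ A : Op N) (v : ℝ≥0) (θ : ℝ) :
    Integrable (fun ℓ : ℝ => (rotatedState ρ₀ (θ + ℓ) * A).trace) (gaussianReal 0 v) := by
  simp only [trace_mul_eq_sum]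
  exact integrable_finsetSum _ fun s _ => integrable_finsetSum _ fun s' _ =>
    (integrable_rotatedState ρ₀ v θ s s').mul_const _

lemma integral_trace (ρ₀ A : Op N) (v : ℝ≥0) (t b : ℝ) :
    ∫ ℓ : ℝ, (rotatedState ρ₀ (b * t + ℓ) * A).trace ∂(gaussianReal 0 v)
      = (outputState ρ₀ v t b * A).trace := by
  simp only [trace_mul_eq_sum]
  rw [integral_finsetSum _ fun s _ => integrable_finsetSum _ fun s' _ =>
    (integrable_rotatedState ρ₀ v _ s s').mul_const _]
  refine Finset.sum_congr rfl fun s _ => ?_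
  rw [integral_finsetSum _ fun s' _ => (integrable_rotatedState ρ₀ v _ s s').mul_const _]
  refine Finset.sum_congr rfl fun s' _ => ?_
  rw [integral_mul_const, outputState_apply]

lemma integrable_mul_trace (ρ₀ A : Op N) (v : ℝ≥0) (θ : ℝ) :
    Integrable (fun ℓ : ℝ => (ℓ : ℂ) * (rotatedState ρ₀ (θ + ℓ) * A).trace)
      (gaussianReal 0 v) := by
  simp only [trace_mul_eq_sum, Finset.mul_sum, ← mul_assoc]
  exact integrable_finsetSum _ fun s _ => integrable_finsetSum _ fun s' _ =>
    (integrable_mul_rotatedState ρ₀ v θ s s').mul_const _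

lemma integral_mul_trace (ρ₀ A : Op N) (v : ℝ≥0) (t b : ℝ) :
    ∫ ℓ : ℝ, (ℓ : ℂ) * (rotatedState ρ₀ (b * t + ℓ) * A).trace ∂(gaussianReal 0 v)
      = v * (generator (outputState ρ₀ v t b) * A).trace := by
  simp only [trace_mul_eq_sum, Finset.mul_sum, ← mul_assoc]
  rw [integral_finsetSum _ fun s _ => integrable_finsetSum _ fun s' _ =>
    (integrable_mul_rotatedState ρ₀ v _ s s').mul_const _]
  refine Finset.sum_congr rfl fun s _ => ?_
  rw [integral_finsetSum _ fun s' _ => (integrable_mul_rotatedState ρ₀ v _ s s').mul_const _]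
  refine Finset.sum_congr rfl fun s' _ => ?_
  rw [integral_mul_const, integral_mul_rotatedState]

lemma outputState_trace {ρ₀ : Op N} (h : IsDensity ρ₀) (v : ℝ≥0) (t b : ℝ) :
    (outputState ρ₀ v t b).trace = 1 := by
  have h1 := integral_trace ρ₀ 1 v t b
  simpa [rotatedState_trace h] using h1.symm

lemma outputState_posSemidef {ρ₀ : Op N} (h : IsDensity ρ₀) (v : ℝ≥0) (t b : ℝ) :
    (outputState ρ₀ v t b).PosSemidef := by
  refine Matrix.PosSemidef.of_dotProduct_mulVec_nonneg ?_ fun x => ?_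
  · ext s s'
    rw [Matrix.conjTranspose_apply, outputState_apply, outputState_apply, Complex.star_def,
      ← integral_conj]
    refine integral_congr_ae (.of_forall fun ℓ => ?_)
    exact (rotatedState_posSemidef h _).isHermitian.apply s s'
  -- A quadratic form is the trace against a rank-one matrix, so it commutes with the average and
  -- stays nonnegative.
  · have h1 : ∀ A : Op N, star x ⬝ᵥ A.mulVec x = (A * Matrix.vecMulVec x (star x)).trace := by
      intro A
      rw [Matrix.mul_vecMulVec, Matrix.trace_vecMulVec, dotProduct_comm]
    rw [h1, ← integral_trace]
    refine integral_nonneg fun ℓ => ?_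
    show 0 ≤ (rotatedState ρ₀ (b * t + ℓ) * Matrix.vecMulVec x (star x)).trace
    rw [← h1]
    exact (rotatedState_posSemidef h _).dotProduct_mulVec_nonneg x

lemma outputState_isDensity {ρ₀ : Op N} (h : IsDensity ρ₀) (v : ℝ≥0) (t b : ℝ) :
    IsDensity (outputState ρ₀ v t b) :=
  ⟨outputState_posSemidef h v t b, outputState_trace h v t b⟩

/-! ### The variance of the collective spin -/

lemma sum_diag_re {ρ : Op N} (h : IsDensity ρ) : ∑ s, (ρ s s).re = 1 := by
  have h1 := congrArg Complex.re h.2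
  simpa [Matrix.trace] using h1

lemma trace_mul_Jz_re (ρ : Op N) :
    (ρ * Jz N).trace.re = ∑ s, (ρ s s).re * spinValue s := by
  simp [Jz_eq_diagonal, Matrix.trace, Matrix.mul_diagonal]

lemma trace_mul_Jz_mul_Jz_re (ρ : Op N) :
    (ρ * (Jz N * Jz N)).trace.re = ∑ s, (ρ s s).re * spinValue s ^ 2 := by
  simp [Jz_eq_diagonal, Matrix.trace, Matrix.mul_diagonal, Matrix.diagonal_mul_diagonal, sq,
    ← Complex.ofReal_mul]

/-- Since `J_z` is diagonal, this is the variance of `spinValue` under the probability vector of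
diagonal entries of `ρ`: Cauchy–Schwarz gives the lower bound, `|spinValue| ≤ N / 2` the upper. -/
lemma variance_nonneg_and_le {ρ : Op N} (h : IsDensity ρ) :
    0 ≤ variance ρ (Jz N) ∧ variance ρ (Jz N) ≤ (N : ℝ) ^ 2 / 4 := by
  have hp : ∀ s, 0 ≤ (ρ s s).re := fun s => (Complex.le_def.mp (h.1.diag_nonneg (i := s))).1
  rw [variance, trace_mul_Jz_re, trace_mul_Jz_mul_Jz_re]
  constructor
  · have h2 := Finset.sum_sq_le_sum_mul_sum_of_sq_le_mul Finset.univ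
      (r := fun s => (ρ s s).re * spinValue s) (f := fun s => (ρ s s).re)
      (g := fun s => (ρ s s).re * spinValue s ^ 2) (fun s _ => hp s)
      (fun s _ => mul_nonneg (hp s) (sq_nonneg _)) (fun s _ => (by ring : _ = _).le)
    rw [sum_diag_re h] at h2
    linarith
  · have h1 : ∑ s, (ρ s s).re * spinValue s ^ 2 ≤ ∑ s, (ρ s s).re * ((N : ℝ) ^ 2 / 4) := by
      refine Finset.sum_le_sum fun s _ => mul_le_mul_of_nonneg_left ?_ (hp s)
      have h2 := sq_le_sq' (abs_le.mp (abs_spinValue_le s)).1 (abs_le.mp (abs_spinValue_le s)).2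
      linarith
    rw [← Finset.sum_mul, sum_diag_re h, one_mul] at h1
    have := sq_nonneg (∑ s, (ρ s s).re * spinValue s)
    linarith

/-- Expectation of `(J_z - ⟨J_z⟩)²`. -/
lemma trace_mul_centered_sq {ρ : Op N} (h : IsDensity ρ) (a : ℝ)
    (ha : a = (ρ * Jz N).trace.re) :
    (ρ * ((Jz N - (a : ℂ) • 1) * (Jz N - (a : ℂ) • 1))).trace.re = variance ρ (Jz N) := by
  have h1 : ρ * ((Jz N - (a : ℂ) • 1) * (Jz N - (a : ℂ) • 1))
      = ρ * (Jz N * Jz N) - (2 * a : ℂ) • (ρ * Jz N) + ((a : ℂ) ^ 2) • ρ := by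
    simp only [mul_sub, sub_mul, Matrix.smul_mul, Matrix.mul_smul, Matrix.one_mul, Matrix.mul_one]
    module
  rw [h1, Matrix.trace_add, Matrix.trace_sub, Matrix.trace_smul, Matrix.trace_smul, h.2, variance,
    ← ha]
  simp [sq, ← ha]
  ring

/-! ### The variational bound -/

lemma trace_mul_conjTranspose_nonneg {ρ : Op N} (h : ρ.PosSemidef) (M : Op N) :
    0 ≤ (ρ * (M * Mᴴ)).trace.re := by
  have h1 := (h.conjTranspose_mul_mul_same M).trace_nonneg
  rw [Matrix.trace_mul_comm, ← mul_assoc, Matrix.trace_mul_comm] at h1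
  exact (Complex.le_def.mp h1).1

/-- The scalar `a` is free because it commutes with `X`; it will be chosen to center `J_z`, so that
the cost is the variance and not the second moment. -/
lemma trace_generator_mul (ρ X : Op N) (a : ℂ) :
    (generator ρ * X).trace
      = Complex.I * (ρ * ((Jz N - a • 1) * X - X * (Jz N - a • 1))).trace := by
  have h1 : (Jz N * ρ * X).trace = (ρ * (X * Jz N)).trace := by
    rw [mul_assoc, Matrix.trace_mul_comm, mul_assoc]
  rw [generator, Matrix.smul_mul, Matrix.trace_smul, sub_mul, Matrix.trace_sub, h1]
  simp only [mul_sub, sub_mul, Matrix.smul_mul, Matrix.mul_smul, Matrix.one_mul, Matrix.mul_one,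
    Matrix.trace_sub, Matrix.trace_smul, mul_assoc, smul_eq_mul]
  ring

/-- The state-dependent single-shot bound. -/
noncomputable def singleShotBound (v t V : ℝ) : ℝ := 4 * t ^ 2 * V / (1 + 4 * v * V)

/-- Averaging the positivity of `(X - K) (X - K)ᴴ` in the rotated states, for a suitable operator
`K` affine in the random angle. -/
lemma variational_bound {ρ₀ : Op N} (h : IsDensity ρ₀) (v : ℝ≥0) (t b : ℝ) {X : Op N}
    (hX : X.IsHermitian) :
    2 * (paramDeriv (outputState ρ₀ v t) b * X).trace.re
        - (outputState ρ₀ v t b * (X * X)).trace.re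
      ≤ singleShotBound v t (variance (outputState ρ₀ v t b) (Jz N)) := by
  set ρ := outputState ρ₀ v t b with hρ
  have hd : IsDensity ρ := outputState_isDensity h v t b
  set V := variance ρ (Jz N) with hV
  have hV0 : 0 ≤ V := (variance_nonneg_and_le hd).1
  have hden : 0 < 1 + 4 * v * V := by positivity
  -- `β` and `γ` minimize `γ² v + 4 β² V` subject to `γ v + β = 1`. The weight of the shift is
  -- written `γ v`, so `v = 0` needs no separate case.
  obtain ⟨β, hβ⟩ : ∃ β : ℝ, β = 1 / (1 + 4 * v * V) := ⟨_, rfl⟩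
  obtain ⟨γ, hγ⟩ : ∃ γ : ℝ, γ = 4 * V / (1 + 4 * v * V) := ⟨_, rfl⟩
  obtain ⟨a, ha⟩ : ∃ a : ℝ, a = (ρ * Jz N).trace.re := ⟨_, rfl⟩
  set J := Jz N - (a : ℂ) • 1 with hJ
  have hJH : Jᴴ = J := by
    rw [hJ, Matrix.conjTranspose_sub, Jz_isHermitian.eq, Matrix.conjTranspose_smul,
      Matrix.conjTranspose_one]
    simp
  set F : ℝ → ℂ := fun ℓ => (rotatedState ρ₀ (b * t + ℓ) * (X * X)).trace
    - (2 * t * γ : ℂ) * ((ℓ : ℂ) * (rotatedState ρ₀ (b * t + ℓ) * X).trace)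
    - (2 * t * β * Complex.I) * (rotatedState ρ₀ (b * t + ℓ) * (J * X - X * J)).trace
    + (t ^ 2 * γ ^ 2 : ℂ) * ((ℓ ^ 2 : ℝ) : ℂ)
    + (4 * t ^ 2 * β ^ 2 : ℂ) * (rotatedState ρ₀ (b * t + ℓ) * (J * J)).trace with hF
  have hpos : ∀ ℓ, 0 ≤ (F ℓ).re := by
    intro ℓ
    -- The real part is proportional to the score of a shifted Gaussian, the anti-Hermitian part
    -- generates the commutator with `J`. In `K Kᴴ` the mixed terms cancel.
    set K : Op N := (t * γ * ℓ : ℂ) • 1 + (2 * t * β * Complex.I) • J with hK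
    have hKH : Kᴴ = (t * γ * ℓ : ℂ) • 1 - (2 * t * β * Complex.I) • J := by
      rw [hK, Matrix.conjTranspose_add, Matrix.conjTranspose_smul, Matrix.conjTranspose_smul,
        Matrix.conjTranspose_one, hJH]
      simp [sub_eq_add_neg]
    have h1 := trace_mul_conjTranspose_nonneg (rotatedState_posSemidef h (b * t + ℓ)) (X - K)
    have h2 : (X - K) * (X - K)ᴴ = X * X - (2 * t * γ * ℓ : ℂ) • X
        - (2 * t * β * Complex.I) • (J * X - X * J)
        + (t ^ 2 * γ ^ 2 * ℓ ^ 2 : ℂ) • 1 + (4 * t ^ 2 * β ^ 2 : ℂ) • (J * J) := by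
      rw [Matrix.conjTranspose_sub, hX.eq, hKH, hK]
      simp only [mul_sub, sub_mul, add_mul, Matrix.smul_mul, Matrix.mul_smul,
        Matrix.one_mul, Matrix.mul_one]
      match_scalars <;> ring_nf
      rw [Complex.I_sq]
      ring
    rw [h2] at h1
    convert h1 using 2
    simp only [hF, mul_add, mul_sub, Matrix.mul_smul, Matrix.trace_add, Matrix.trace_sub,
      Matrix.trace_smul, Matrix.mul_one, rotatedState_trace h, smul_eq_mul]
    push_cast
    ring
  have i1 := integrable_trace ρ₀ (X * X) v (b * t)
  have i2 := (integrable_mul_trace ρ₀ X v (b * t)).const_mul (2 * t * γ : ℂ)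
  have i3 := (integrable_trace ρ₀ (J * X - X * J) v (b * t)).const_mul (2 * t * β * Complex.I)
  have i4 := ((integrable_sq_gaussianReal v).ofReal (𝕜 := ℂ)).const_mul (t ^ 2 * γ ^ 2 : ℂ)
  have i5 := (integrable_trace ρ₀ (J * J) v (b * t)).const_mul (4 * t ^ 2 * β ^ 2 : ℂ)
  have hint : ∫ ℓ, F ℓ ∂(gaussianReal 0 v) = (ρ * (X * X)).trace
      - (2 * t * γ : ℂ) * (v * (generator ρ * X).trace)
      - (2 * t * β * Complex.I) * (ρ * (J * X - X * J)).trace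
      + (t ^ 2 * γ ^ 2 : ℂ) * ((v : ℝ) : ℂ)
      + (4 * t ^ 2 * β ^ 2 : ℂ) * (ρ * (J * J)).trace := by
    have h3 := integral_add' (((i1.sub i2).sub i3).add i4) i5
    rw [integral_add' ((i1.sub i2).sub i3) i4, integral_sub' (i1.sub i2) i3, integral_sub' i1 i2,
      integral_const_mul, integral_const_mul, integral_const_mul, integral_const_mul,
      integral_trace, integral_mul_trace, integral_trace, integral_trace, integral_ofReal,
      integral_sq_gaussianReal] at h3
    exact h3
  have hFi : Integrable F (gaussianReal 0 v) := (((i1.sub i2).sub i3).add i4).add i5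
  have hre : 0 ≤ (∫ ℓ, F ℓ ∂(gaussianReal 0 v)).re := by
    have h3 := integral_re hFi
    have h4 : 0 ≤ ∫ ℓ, RCLike.re (F ℓ) ∂(gaussianReal 0 v) := integral_nonneg hpos
    rw [h3] at h4
    exact h4
  -- Both linear terms are now multiples of the same trace `Tr(generator ρ * X)`, with total weight
  -- `γ v + β = 1`.
  have hgen : (2 * t * β * Complex.I) * (ρ * (J * X - X * J)).trace
      = (2 * t * β : ℂ) * (generator ρ * X).trace := by
    rw [trace_generator_mul ρ X a]
    ring
  rw [hint, hgen] at hre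
  have hJJ : (ρ * (J * J)).trace.re = V := trace_mul_centered_sq hd a ha
  have hre2 : 0 ≤ (ρ * (X * X)).trace.re - 2 * t * (γ * v + β) * (generator ρ * X).trace.re
      + t ^ 2 * γ ^ 2 * v + 4 * t ^ 2 * β ^ 2 * V := by
    convert hre using 1
    rw [← hJJ]
    norm_cast
    simp only [Complex.add_re, Complex.sub_re, Complex.re_ofReal_mul, Complex.ofReal_re]
    ring
  have e1 : γ * v + β = 1 := by rw [hγ, hβ]; field_simp; ring
  have e2 : γ ^ 2 * v + 4 * β ^ 2 * V = 4 * V / (1 + 4 * v * V) := by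
    rw [hγ, hβ]; field_simp; ring
  rw [e1] at hre2
  rw [paramDeriv_outputState, ← hρ, Matrix.smul_mul, Matrix.trace_smul, smul_eq_mul,
    Complex.re_ofReal_mul, singleShotBound, mul_comm 4 (t ^ 2), mul_assoc, mul_div_assoc, ← e2]
  linarith

/-! ### The quantum Fisher information -/

open Classical in
/-- The symmetric logarithmic derivative attains equality between the quantum Fisher information
and its variational expression. -/
lemma exists_qfi_eq (ρ : ℝ → Op N) (b : ℝ) (h : (ρ b).PosSemidef)
    (hD : (paramDeriv ρ b).IsHermitian) :
    ∃ X : Op N, X.IsHermitian ∧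
      qfi ρ b = 2 * (paramDeriv ρ b * X).trace.re - (ρ b * (X * X)).trace.re := by
  set lam := h.isHermitian.eigenvalues
  set U : Op N := (h.isHermitian.eigenvectorUnitary : Op N) with hU
  have hUU : Uᴴ * U = 1 := (Matrix.mem_unitaryGroup_iff'.mp h.isHermitian.eigenvectorUnitary.2)
  have hρ : ρ b = U * Matrix.diagonal (fun i => (lam i : ℂ)) * Uᴴ := by
    have h1 := h.isHermitian.spectral_theorem
    rw [Unitary.conjStarAlgAut_apply] at h1
    exact h1
  set D := Uᴴ * paramDeriv ρ b * U with hDdef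
  have hDH : D.IsHermitian := by
    rw [hDdef]
    exact Matrix.isHermitian_conjTranspose_mul_mul U hD
  -- The symmetric logarithmic derivative in the eigenbasis of `ρ b`, set to zero where `qfi` drops
  -- the term.
  set L : Op N := Matrix.of fun i j =>
    if 0 < lam i + lam j then 2 * D i j / ((lam i + lam j : ℝ) : ℂ) else 0 with hL
  have hLH : L.IsHermitian := by
    refine Matrix.IsHermitian.ext fun i j => ?_
    simp only [hL, Matrix.of_apply, add_comm (lam j) (lam i)]
    split_ifs
    · have h1 : (starRingEnd ℂ) (D j i) = D i j := hDH.apply i j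
      rw [Complex.star_def, map_div₀, map_mul, h1, Complex.conj_ofReal, Complex.conj_ofNat]
    · simp
  refine ⟨U * L * Uᴴ, Matrix.isHermitian_mul_mul_conjTranspose U hLH, ?_⟩
  have t1 : (paramDeriv ρ b * (U * L * Uᴴ)).trace = (D * L).trace := by
    rw [hDdef, ← mul_assoc, Matrix.trace_mul_comm]
    simp only [mul_assoc]
  have t2 : (ρ b * (U * L * Uᴴ * (U * L * Uᴴ))).trace
      = (Matrix.diagonal (fun i => (lam i : ℂ)) * (L * L)).trace := by
    have h1 : ρ b * (U * L * Uᴴ * (U * L * Uᴴ))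
        = U * (Matrix.diagonal (fun i => (lam i : ℂ)) * (L * L) * Uᴴ) := by
      calc ρ b * (U * L * Uᴴ * (U * L * Uᴴ))
          = U * Matrix.diagonal (fun i => (lam i : ℂ)) * (Uᴴ * U) * L * (Uᴴ * U) * L * Uᴴ := by
            rw [hρ]; simp only [mul_assoc]
        _ = _ := by rw [hUU]; simp only [mul_assoc, mul_one]
    rw [h1, Matrix.trace_mul_comm, mul_assoc, hUU, mul_one]
  have e1 : (D * L).trace.re = ∑ i, ∑ j,
      if 0 < lam i + lam j then 2 * (‖D i j‖ ^ 2 / (lam i + lam j)) else 0 := by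
    rw [trace_mul_eq_sum, Complex.re_sum]
    refine Finset.sum_congr rfl fun i _ => ?_
    rw [Complex.re_sum]
    refine Finset.sum_congr rfl fun j _ => ?_
    simp only [hL, Matrix.of_apply, add_comm (lam j) (lam i)]
    split_ifs
    · have h1 : D i j * (2 * D j i / ((lam i + lam j : ℝ) : ℂ))
          = ((2 * (‖D i j‖ ^ 2 / (lam i + lam j)) : ℝ) : ℂ) := by
        rw [← hDH.apply j i, Complex.star_def]
        have h2 := Complex.mul_conj' (D i j)
        push_cast
        rw [← h2]
        ring
      rw [h1, Complex.ofReal_re]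
    · simp
  have e2 : (Matrix.diagonal (fun i => (lam i : ℂ)) * (L * L)).trace.re
      = ∑ i, ∑ j, lam i * ‖L i j‖ ^ 2 := by
    simp only [Matrix.trace, Matrix.diag, Matrix.diagonal_mul, Complex.re_sum]
    refine Finset.sum_congr rfl fun i _ => ?_
    rw [Complex.re_ofReal_mul, Matrix.mul_apply, Complex.re_sum, Finset.mul_sum]
    refine Finset.sum_congr rfl fun j _ => ?_
    rw [← hLH.apply j i, Complex.star_def, Complex.mul_conj', ← Complex.ofReal_pow,
      Complex.ofReal_re]
  have hsymm : ∀ i j, ‖L i j‖ = ‖L j i‖ := fun i j => by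
    rw [← hLH.apply j i, norm_star]
  -- As `‖L i j‖` is symmetric, `lam i` may be replaced by `(lam i + lam j) / 2`, which cancels one
  -- denominator. Both traces then equal the same sum `x`, and `2 x - x = x`.
  have e3 : ∑ i, ∑ j, lam i * ‖L i j‖ ^ 2 = ∑ i, ∑ j,
      if 0 < lam i + lam j then 2 * (‖D i j‖ ^ 2 / (lam i + lam j)) else 0 := by
    have h1 : ∑ i, ∑ j, lam i * ‖L i j‖ ^ 2 = ∑ i, ∑ j, lam j * ‖L i j‖ ^ 2 := by
      rw [Finset.sum_comm]
      refine Finset.sum_congr rfl fun i _ => Finset.sum_congr rfl fun j _ => ?_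
      rw [hsymm]
    have h2 : ∑ i, ∑ j, lam i * ‖L i j‖ ^ 2
        = ∑ i, ∑ j, (lam i + lam j) / 2 * ‖L i j‖ ^ 2 := by
      have h3 : ∑ i, ∑ j, (lam i + lam j) / 2 * ‖L i j‖ ^ 2
          = (∑ i, ∑ j, lam i * ‖L i j‖ ^ 2 + ∑ i, ∑ j, lam j * ‖L i j‖ ^ 2) / 2 := by
        simp only [← Finset.sum_add_distrib, Finset.sum_div]
        refine Finset.sum_congr rfl fun i _ => Finset.sum_congr rfl fun j _ => ?_
        ring
      rw [h3, ← h1]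
      ring
    rw [h2]
    refine Finset.sum_congr rfl fun i _ => Finset.sum_congr rfl fun j _ => ?_
    simp only [hL, Matrix.of_apply]
    split_ifs with hp
    · rw [norm_div, norm_mul, Complex.norm_real, Real.norm_of_nonneg hp.le]
      simp
      field_simp
    · simp
  rw [t1, t2, e1, e2, e3, qfi, dif_pos h.isHermitian]
  have e4 : ∀ x : ℝ, 2 * x - x = x := fun x => by ring
  rw [e4, Finset.mul_sum]
  refine Finset.sum_congr rfl fun i _ => ?_
  rw [Finset.mul_sum]
  refine Finset.sum_congr rfl fun j _ => ?_
  rw [mul_ite, mul_zero]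

lemma generator_isHermitian {ρ : Op N} (h : ρ.IsHermitian) : (generator ρ).IsHermitian := by
  refine Matrix.IsHermitian.ext fun s s' => ?_
  rw [generator_apply, generator_apply, star_mul', h.apply s s', Complex.star_def, map_neg,
    map_mul, map_sub, Complex.conj_I, Complex.conj_ofReal, Complex.conj_ofReal]
  ring

lemma paramDeriv_isHermitian {ρ₀ : Op N} (h : IsDensity ρ₀) (v : ℝ≥0) (t b : ℝ) :
    (paramDeriv (outputState ρ₀ v t) b).IsHermitian := by
  rw [paramDeriv_outputState]
  refine Matrix.IsHermitian.ext fun s s' => ?_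
  rw [Matrix.smul_apply, Matrix.smul_apply, star_smul,
    (generator_isHermitian (outputState_posSemidef h v t b).isHermitian).apply s s']
  simp

theorem qfi_le_singleShotBound {ρ₀ : Op N} (h : IsDensity ρ₀) (v : ℝ≥0) (t b : ℝ) :
    qfi (outputState ρ₀ v t) b
      ≤ singleShotBound v t (variance (outputState ρ₀ v t b) (Jz N)) := by
  obtain ⟨X, hX, hq⟩ := exists_qfi_eq (outputState ρ₀ v t) b (outputState_posSemidef h v t b)
    (paramDeriv_isHermitian h v t b)
  rw [hq]
  exact variational_bound h v t b hX

/-! ### The classical Cramér–Rao bound for repeated measurements -/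

section Classical

variable {α κ : Type*} [Fintype α] [Fintype κ] [DecidableEq κ]

/-- Absorbing `x (μ k)` into the `k`-th factor makes the sum over strings factorize, and the `k`-th
factor is the mean of `x`. -/
lemma sum_prod_mul_sum_score (p x : α → ℝ) (h0 : ∑ a, p a * x a = 0) :
    ∑ μ : κ → α, (∏ k, p (μ k)) * ∑ k, x (μ k) = 0 := by
  simp only [Finset.mul_sum]
  rw [Finset.sum_comm]
  refine Finset.sum_eq_zero fun k _ => ?_
  have h1 : ∀ μ : κ → α, (∏ j, p (μ j)) * x (μ k)
      = ∏ j, p (μ j) * (if j = k then x (μ j) else 1) := fun μ => by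
    rw [Finset.prod_mul_distrib, Finset.prod_ite_eq' Finset.univ k, if_pos (Finset.mem_univ k)]
  simp only [h1]
  rw [← Fintype.piFinset_univ,
    ← Finset.prod_univ_sum (fun _ => Finset.univ)
      (fun j a => p a * (if j = k then x a else 1))]
  exact Finset.prod_eq_zero (Finset.mem_univ k) (by simpa using h0)

/-- Additivity of Fisher information: variances of independent centered variables add, the terms `k
≠ l` of the expanded square vanishing. -/
lemma sum_prod_mul_sq_sum_score (p x : α → ℝ) (h1 : ∑ a, p a = 1) (h0 : ∑ a, p a * x a = 0) :
    ∑ μ : κ → α, (∏ k, p (μ k)) * (∑ k, x (μ k)) ^ 2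
      = Fintype.card κ * ∑ a, p a * x a ^ 2 := by
  have hexp : ∀ μ : κ → α, (∏ k, p (μ k)) * (∑ k, x (μ k)) ^ 2 = ∑ k, ∑ l, ∏ j,
      p (μ j) * ((if j = k then x (μ j) else 1) * (if j = l then x (μ j) else 1)) := fun μ => by
    rw [sq, Finset.sum_mul_sum, Finset.mul_sum]
    refine Finset.sum_congr rfl fun k _ => ?_
    rw [Finset.mul_sum]
    refine Finset.sum_congr rfl fun l _ => ?_
    rw [Finset.prod_mul_distrib, Finset.prod_mul_distrib, Finset.prod_ite_eq' Finset.univ k,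
      Finset.prod_ite_eq' Finset.univ l, if_pos (Finset.mem_univ k), if_pos (Finset.mem_univ l)]
  simp only [hexp]
  rw [Finset.sum_comm]
  have hk : ∀ k : κ, ∑ μ : κ → α, ∑ l, ∏ j,
      p (μ j) * ((if j = k then x (μ j) else 1) * (if j = l then x (μ j) else 1))
      = ∑ a, p a * x a ^ 2 := fun k => by
    rw [Finset.sum_comm]
    have hl : ∀ l : κ, ∑ μ : κ → α, ∏ j,
        p (μ j) * ((if j = k then x (μ j) else 1) * (if j = l then x (μ j) else 1))
        = if l = k then ∑ a, p a * x a ^ 2 else 0 := fun l => by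
      rw [← Fintype.piFinset_univ, ← Finset.prod_univ_sum (fun _ => Finset.univ)
        (fun j a => p a * ((if j = k then x a else 1) * (if j = l then x a else 1)))]
      split_ifs with hkl
      · subst hkl
        rw [Finset.prod_eq_single l (fun j _ hj => by simp [hj, h1]) (by simp)]
        simp [sq]
      · refine Finset.prod_eq_zero (Finset.mem_univ k) ?_
        simpa [Ne.symm hkl] using h0
    rw [Finset.sum_congr rfl fun l _ => hl l, Finset.sum_ite_eq' Finset.univ k,
      if_pos (Finset.mem_univ k)]
  rw [Finset.sum_congr rfl fun k _ => hk k, Finset.sum_const, Finset.card_univ, nsmul_eq_mul]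

end Classical

-- Factors a POVM element so that `trace_mul_conjTranspose_nonneg` applies to it.
open scoped MatrixOrder Matrix.Norms.L2Operator in
lemma exists_eq_conjTranspose_mul_self {E : Op N} (h : E.PosSemidef) :
    ∃ B : Op N, E = Bᴴ * B :=
  CStarAlgebra.nonneg_iff_eq_star_mul_self.mp h.nonneg

namespace Protocol

variable (P : Protocol N) (v : ℝ → ℝ≥0)

/-- The probability of a single outcome. -/
noncomputable def outcomeProb (b : ℝ) (a : Fin P.outcomes) : ℝ :=
  (outputState P.input (v P.time) P.time b * P.povm a).trace.re

/-- The derivative of the probability of a single outcome. -/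
noncomputable def outcomeProbDeriv (b : ℝ) (a : Fin P.outcomes) : ℝ :=
  (paramDeriv (outputState P.input (v P.time) P.time) b * P.povm a).trace.re

lemma hasDerivAt_outcomeProb (b : ℝ) (a : Fin P.outcomes) :
    HasDerivAt (fun x => P.outcomeProb v x a) (P.outcomeProbDeriv v b a) b := by
  have h1 : HasDerivAt
      (fun x => (outputState P.input (v P.time) P.time x * P.povm a).trace)
      (paramDeriv (outputState P.input (v P.time) P.time) b * P.povm a).trace b := by
    simp only [trace_mul_eq_sum]
    refine HasDerivAt.fun_sum fun s _ => HasDerivAt.fun_sum fun s' _ => ?_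
    have h2 := hasDerivAt_outputState P.input (v P.time) P.time b s s'
    exact (h2.differentiableAt.hasDerivAt).mul_const _
  have h3 := (Complex.reCLM.hasFDerivAt.comp_hasDerivAt b h1)
  exact h3

lemma outcomeProb_nonneg (b : ℝ) (a : Fin P.outcomes) : 0 ≤ P.outcomeProb v b a := by
  obtain ⟨B, hB⟩ := exists_eq_conjTranspose_mul_self (P.povm_pos a)
  have h1 := trace_mul_conjTranspose_nonneg
    (outputState_posSemidef P.input_density (v P.time) P.time b) Bᴴ
  rw [Matrix.conjTranspose_conjTranspose] at h1
  rw [outcomeProb, hB]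
  exact h1

lemma sum_outcomeProb (b : ℝ) : ∑ a, P.outcomeProb v b a = 1 := by
  simp only [outcomeProb]
  rw [← Complex.re_sum, ← Matrix.trace_sum, ← Finset.mul_sum, P.povm_sum, mul_one,
    outputState_trace P.input_density, Complex.one_re]

lemma sum_outcomeProbDeriv (b : ℝ) : ∑ a, P.outcomeProbDeriv v b a = 0 := by
  have h1 := HasDerivAt.fun_sum fun a (_ : a ∈ Finset.univ) => P.hasDerivAt_outcomeProb v b a
  simp only [sum_outcomeProb] at h1
  exact h1.unique (hasDerivAt_const b 1)

/-- The score (logarithmic derivative) of a single outcome. -/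
noncomputable def score (b : ℝ) (a : Fin P.outcomes) : ℝ :=
  P.outcomeProbDeriv v b a / P.outcomeProb v b a

/-- An outcome of probability zero is harmless: a nonnegative function has zero derivative where it
vanishes, so the convention `x / 0 = 0` in `score` loses nothing. -/
lemma outcomeProb_mul_score (b : ℝ) (a : Fin P.outcomes) :
    P.outcomeProb v b a * P.score v b a = P.outcomeProbDeriv v b a := by
  by_cases h : P.outcomeProb v b a = 0
  · have hmin : IsLocalMin (fun x => P.outcomeProb v x a) b :=
      .of_forall fun x => by beta_reduce; rw [h]; exact P.outcomeProb_nonneg v x a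
    rw [h, zero_mul, hmin.hasDerivAt_eq_zero (P.hasDerivAt_outcomeProb v b a)]
  · exact mul_div_cancel₀ _ h

/-- The Fisher information of the measurement is at most the single-shot bound. -/
lemma fisher_le (b : ℝ) :
    ∑ a, P.outcomeProb v b a * P.score v b a ^ 2 ≤ singleShotBound (v P.time) P.time
      (variance (outputState P.input (v P.time) P.time b) (Jz N)) := by
  set ρ := outputState P.input (v P.time) P.time b with hρ
  set x := P.score v b with hx
  -- With this test operator the linear term is twice the Fisher information `I`, and `e2` bounds
  -- the quadratic term by `I`, leaving `I` below the bound.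
  set X : Op N := ∑ a, (x a : ℂ) • P.povm a with hX
  have hXH : X.IsHermitian := by
    rw [Matrix.IsHermitian, hX, Matrix.conjTranspose_sum]
    refine Finset.sum_congr rfl fun a _ => ?_
    rw [Matrix.conjTranspose_smul, (P.povm_pos a).isHermitian.eq]
    simp
  have hvar := variational_bound P.input_density (v P.time) P.time b hXH
  have e1 : (paramDeriv (outputState P.input (v P.time) P.time) b * X).trace.re
      = ∑ a, P.outcomeProb v b a * x a ^ 2 := by
    rw [hX, Finset.mul_sum, Matrix.trace_sum, Complex.re_sum]
    refine Finset.sum_congr rfl fun a _ => ?_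
    rw [Matrix.mul_smul, Matrix.trace_smul, smul_eq_mul, Complex.re_ofReal_mul, sq, ← mul_assoc,
      hx, outcomeProb_mul_score, outcomeProbDeriv, mul_comm]
  -- The operator inequality `X² ≤ ∑ x_a² E_a` for the POVM elements `E_a`, from expanding `∑ (x_a -
  -- X) E_a (x_a - X) ≥ 0` with `∑ E_a = 1`.
  have e2 : (ρ * (X * X)).trace.re ≤ ∑ a, P.outcomeProb v b a * x a ^ 2 := by
    have h1 : ∀ a, 0 ≤ (ρ * (((x a : ℂ) • 1 - X) * P.povm a * ((x a : ℂ) • 1 - X))).trace.re := by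
      intro a
      obtain ⟨B, hB⟩ := exists_eq_conjTranspose_mul_self (P.povm_pos a)
      have h2 := trace_mul_conjTranspose_nonneg
        (outputState_posSemidef P.input_density (v P.time) P.time b)
        (((x a : ℂ) • 1 - X) * Bᴴ)
      have h3 : ((x a : ℂ) • 1 - X)ᴴ = (x a : ℂ) • 1 - X := by
        rw [Matrix.conjTranspose_sub, hXH.eq, Matrix.conjTranspose_smul, Matrix.conjTranspose_one]
        simp
      rw [Matrix.conjTranspose_mul, Matrix.conjTranspose_conjTranspose, h3] at h2
      rw [hB]
      simpa only [mul_assoc] using h2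
    have h4 : ∑ a, ((x a : ℂ) • 1 - X) * P.povm a * ((x a : ℂ) • 1 - X)
        = ∑ a, ((x a ^ 2 : ℝ) : ℂ) • P.povm a - X * X := by
      have h5 : ∀ a, ((x a : ℂ) • 1 - X) * P.povm a * ((x a : ℂ) • 1 - X)
          = ((x a ^ 2 : ℝ) : ℂ) • P.povm a - ((x a : ℂ) • P.povm a) * X
            - X * ((x a : ℂ) • P.povm a) + X * P.povm a * X := fun a => by
        simp only [mul_sub, sub_mul, Matrix.smul_mul, Matrix.mul_smul, Matrix.one_mul,
          Matrix.mul_one]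
        push_cast
        module
      simp only [h5, Finset.sum_add_distrib, Finset.sum_sub_distrib]
      rw [← Finset.sum_mul, ← Finset.mul_sum, ← Finset.sum_mul, ← Finset.mul_sum, P.povm_sum,
        ← hX, Matrix.mul_one]
      abel
    have h6 : 0 ≤ (ρ * ∑ a, ((x a : ℂ) • 1 - X) * P.povm a * ((x a : ℂ) • 1 - X)).trace.re := by
      rw [Finset.mul_sum, Matrix.trace_sum, Complex.re_sum]
      exact Finset.sum_nonneg fun a _ => h1 a
    rw [h4, mul_sub, Matrix.trace_sub, Complex.sub_re, Finset.mul_sum, Matrix.trace_sum,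
      Complex.re_sum] at h6
    have h7 : ∑ a, (ρ * ((x a ^ 2 : ℝ) : ℂ) • P.povm a).trace.re
        = ∑ a, P.outcomeProb v b a * x a ^ 2 := by
      refine Finset.sum_congr rfl fun a _ => ?_
      rw [Matrix.mul_smul, Matrix.trace_smul, smul_eq_mul, Complex.re_ofReal_mul, mul_comm]
      rfl
    rw [h7] at h6
    linarith
  rw [e1] at hvar
  linarith

lemma hasDerivAt_mean (b : ℝ) :
    HasDerivAt (P.mean v)
      (∑ μ, P.prob v b μ * (∑ k, P.score v b (μ k)) * P.estimate μ) b := by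
  refine HasDerivAt.fun_sum fun μ _ => HasDerivAt.mul_const ?_ _
  have h1 := HasDerivAt.fun_finsetProd (u := Finset.univ) (x := b)
    (f := fun (k : Fin P.shots) x => P.outcomeProb v x (μ k))
    (f' := fun k => P.outcomeProbDeriv v b (μ k))
    (fun k _ => P.hasDerivAt_outcomeProb v b (μ k))
  refine h1.congr_deriv ?_
  rw [Finset.mul_sum]
  refine Finset.sum_congr rfl fun k _ => ?_
  rw [← outcomeProb_mul_score, smul_eq_mul, ← mul_assoc, Finset.prod_erase_mul _ _ (Finset.mem_univ k)]
  rfl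

/-- The Cramér–Rao inequality. -/
theorem one_le_errorSq_mul {b : ℝ} (hP : P.IsLocallyUnbiased v b) :
    1 ≤ P.errorSq v b * (P.shots * singleShotBound (v P.time) P.time
      (variance (outputState P.input (v P.time) P.time b) (Jz N))) := by
  have hp : ∀ μ, 0 ≤ P.prob v b μ := fun μ =>
    Finset.prod_nonneg fun k _ => P.outcomeProb_nonneg v b (μ k)
  have hs : ∑ a, P.outcomeProb v b a * P.score v b a = 0 := by
    simp only [outcomeProb_mul_score, sum_outcomeProbDeriv]
  have h1 : ∑ μ, P.prob v b μ * ∑ k, P.score v b (μ k) = 0 :=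
    sum_prod_mul_sum_score (κ := Fin P.shots) (P.outcomeProb v b) (P.score v b) hs
  have h2 : ∑ μ, P.prob v b μ * (∑ k, P.score v b (μ k)) ^ 2
      = P.shots * ∑ a, P.outcomeProb v b a * P.score v b a ^ 2 := by
    have h3 := sum_prod_mul_sq_sum_score (κ := Fin P.shots) (P.outcomeProb v b) (P.score v b)
      (P.sum_outcomeProb v b) hs
    rw [Fintype.card_fin] at h3
    exact h3
  -- The covariance of the total score and the estimate is the derivative of the mean, as the score
  -- is centered; Cauchy–Schwarz finishes.
  have h4 : ∑ μ, P.prob v b μ * (∑ k, P.score v b (μ k)) * (P.estimate μ - P.mean v b) = 1 := by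
    simp only [mul_sub, Finset.sum_sub_distrib]
    rw [← Finset.sum_mul, h1, zero_mul, sub_zero]
    exact (P.hasDerivAt_mean v b).unique hP.2
  have hcs := Finset.sum_sq_le_sum_mul_sum_of_sq_le_mul Finset.univ
    (r := fun μ => P.prob v b μ * (∑ k, P.score v b (μ k)) * (P.estimate μ - P.mean v b))
    (f := fun μ => P.prob v b μ * (P.estimate μ - P.mean v b) ^ 2)
    (g := fun μ => P.prob v b μ * (∑ k, P.score v b (μ k)) ^ 2)
    (fun μ _ => mul_nonneg (hp μ) (sq_nonneg _)) (fun μ _ => mul_nonneg (hp μ) (sq_nonneg _))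
    (fun μ _ => (by ring : _ = _).le)
  rw [h4, h2, one_pow] at hcs
  refine hcs.trans (mul_le_mul_of_nonneg_left
    (mul_le_mul_of_nonneg_left (P.fisher_le v b) (Nat.cast_nonneg _)) ?_)
  exact Finset.sum_nonneg fun μ _ => mul_nonneg (hp μ) (sq_nonneg _)

lemma errorSq_nonneg (b : ℝ) : 0 ≤ P.errorSq v b :=
  Finset.sum_nonneg fun μ _ => mul_nonneg
    (Finset.prod_nonneg fun k _ => P.outcomeProb_nonneg v b (μ k)) (sq_nonneg _)

end Protocol

/-! ### From the rate to the total quantum Fisher information and the precision -/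

/-- Allows the variance `c * χ t` to be replaced by the smaller `χ t`, treating both normalizations
at once. -/
lemma singleShotBound_anti {x v : ℝ} (hx : 0 ≤ x) (hxv : x ≤ v) (t : ℝ) {V : ℝ} (hV : 0 ≤ V) :
    singleShotBound v t V ≤ singleShotBound x t V := by
  unfold singleShotBound
  gcongr

lemma singleShotBound_le {x : ℝ} (hx : 0 ≤ x) (t : ℝ) {V : ℝ} (hV : 0 ≤ V)
    (hVN : V ≤ (N : ℝ) ^ 2 / 4) :
    singleShotBound x t V ≤ (N : ℝ) ^ 2 * t ^ 2 / (1 + x * (N : ℝ) ^ 2) := by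
  unfold singleShotBound
  rw [div_le_div_iff₀ (by positivity) (by positivity)]
  -- After cross-multiplication the terms in `x` cancel and only `4 t² V ≤ N² t²` is left.
  have h1 : 0 ≤ t ^ 2 * ((N : ℝ) ^ 2 / 4 - V) := mul_nonneg (sq_nonneg t) (by linarith)
  nlinarith

lemma singleShotBound_outputState_le {ρ₀ : Op N} (h : IsDensity ρ₀) {χ : ℝ} {v : ℝ≥0}
    (hχ : 0 ≤ χ) (hv : χ ≤ v) (t b : ℝ) :
    singleShotBound v t (variance (outputState ρ₀ v t b) (Jz N))
      ≤ (N : ℝ) ^ 2 * t ^ 2 / (1 + χ * (N : ℝ) ^ 2) := by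
  obtain ⟨h0, h1⟩ := variance_nonneg_and_le (outputState_isDensity h v t b)
  exact (singleShotBound_anti hχ hv t h0).trans (singleShotBound_le hχ t h0 h1)

lemma mul_rateBound (χ : ℝ → ℝ) (N : ℕ) (t : ℝ) :
    t * rateBound χ N t = (N : ℝ) ^ 2 * t ^ 2 / (1 + χ t * (N : ℝ) ^ 2) := by
  rw [rateBound]
  ring

lemma rateBound_nonneg (χ : ℝ → ℝ≥0) (N : ℕ) {t : ℝ} (ht : 0 ≤ t) :
    0 ≤ rateBound (fun s => χ s) N t := by
  rw [rateBound]
  positivity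

lemma qfi_le_mul_rateBound {ρ₀ : Op N} (h : IsDensity ρ₀) {χ v : ℝ → ℝ≥0} (hv : ∀ t, χ t ≤ v t)
    (t b : ℝ) : qfi (outputState ρ₀ (v t) t) b ≤ t * rateBound (fun s => χ s) N t := by
  rw [mul_rateBound]
  exact (qfi_le_singleShotBound h (v t) t b).trans
    (singleShotBound_outputState_le h (χ t).coe_nonneg (by exact_mod_cast hv t) t b)

lemma ofReal_mul_qfi_le {ρ₀ : Op N} (h : IsDensity ρ₀) {χ v : ℝ → ℝ≥0} (hv : ∀ t, χ t ≤ v t)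
    {T t : ℝ} (hT : 0 < T) (ht : 0 < t) (b : ℝ) :
    ENNReal.ofReal (T / t * qfi (outputState ρ₀ (v t) t) b)
      ≤ ENNReal.ofReal (T * rateBound (fun s => χ s) N t) := by
  refine ENNReal.ofReal_le_ofReal ?_
  have h1 := mul_le_mul_of_nonneg_left (qfi_le_mul_rateBound h hv t b) (div_pos hT ht).le
  refine h1.trans_eq ?_
  field_simp

lemma totalQFI_le_ofReal {χ v : ℝ → ℝ≥0} (hv : ∀ t, χ t ≤ v t) {T C : ℝ} (hT : 0 < T)
    (hC : ∀ t, 0 < t → T * rateBound (fun s => χ s) N t ≤ C) (b : ℝ) :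
    totalQFI N v (Set.Ioi 0) T b ≤ ENNReal.ofReal C :=
  iSup₂_le fun _ h => iSup₂_le fun t ht =>
    (ofReal_mul_qfi_le h hv hT ht b).trans (ENNReal.ofReal_le_ofReal (hC t ht))

/-- The rate hypothesis is kept in product form so that a vanishing rate needs no division. For
estimators, `ν` shots of duration `t` give `ν * (t * rate) = T * rate`. -/
lemma precisionAtLeast_of_rateBound {χ v : ℝ → ℝ≥0} (hv : ∀ t, χ t ≤ v t) {S : Set ℝ}
    (hS : S ⊆ Set.Ioi 0) {T B : ℝ} (hT : 0 < T) (hB : 0 ≤ B)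
    (h : ∀ t ∈ S, rateBound (fun s => χ s) N t * (B * T) ≤ 1) (b : ℝ) :
    PrecisionAtLeast N v S T b B := by
  refine ⟨le_iInf₂ fun ρ₀ hρ₀ => le_iInf₂ fun t ht => ?_, fun P hPS hPT hP => ?_⟩
  · have ht0 : 0 < t := hS ht
    have hq := qfi_le_mul_rateBound hρ₀ hv t b
    rcases le_or_gt (T * qfi (outputState ρ₀ (v t) t) b) 0 with h0 | h0
    · rw [ENNReal.ofReal_of_nonpos h0, ENNReal.div_zero (by simpa using ht0)]
      exact le_top
    · rw [← ENNReal.ofReal_div_of_pos h0]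
      refine ENNReal.ofReal_le_ofReal ?_
      rw [le_div_iff₀ h0]
      have h1 := mul_le_mul_of_nonneg_left hq (mul_nonneg hB hT.le)
      have h2 := mul_le_mul_of_nonneg_left (h t ht) ht0.le
      nlinarith
  · have ht0 : 0 < P.time := P.time_pos
    have hr := rateBound_nonneg χ N ht0.le
    have h1 := P.one_le_errorSq_mul v hP
    have h2 := singleShotBound_outputState_le P.input_density (χ P.time).coe_nonneg
      (v := v P.time) (by exact_mod_cast hv P.time) P.time b
    rw [← mul_rateBound (fun s => (χ s : ℝ))] at h2
    have he := P.errorSq_nonneg v b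
    have h3 : 1 ≤ P.errorSq v b * (T * rateBound (fun s => χ s) N P.time) := by
      refine h1.trans (mul_le_mul_of_nonneg_left ?_ he)
      rw [← hPT, Protocol.runtime, mul_assoc]
      exact mul_le_mul_of_nonneg_left h2 (Nat.cast_nonneg _)
    -- A zero rate would contradict the Cramér–Rao inequality `h3`: no locally unbiased estimator
    -- exists then.
    have h4 : 0 < T * rateBound (fun s => χ s) N P.time := by
      refine lt_of_le_of_ne (mul_nonneg hT.le hr) fun h0 => ?_
      rw [← h0] at h3
      norm_num at h3
    have h5 := h P.time hPS
    refine le_of_mul_le_mul_right ?_ h4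
    linarith

/-! ### Optimization of the rate -/

section PowerLaw

variable {n κ : ℝ}

lemma tStar_pos {χ₀ ω : ℝ} (hn : 1 < n) (hχ : 0 < χ₀) (hω : 0 < ω) (hN : 1 ≤ N) :
    0 < tStar χ₀ ω n N := by
  have h1 : 0 < n - 1 := by linarith
  have h2 : (0 : ℝ) < N := by exact_mod_cast hN
  unfold tStar
  positivity

/-- At the optimal time, `χ(t) N² = 1 / (n - 1)`. -/
lemma tStar_rpow_mul {χ₀ ω : ℝ} (hn : 1 < n) (hχ : 0 < χ₀) (hω : 0 < ω) (hN : 1 ≤ N) :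
    (χ₀ * ω * tStar χ₀ ω n N) ^ n * (N : ℝ) ^ 2 = 1 / (n - 1) := by
  have h1 : 0 < n - 1 := by linarith
  have h2 : (0 : ℝ) < N := by exact_mod_cast hN
  have hn0 : n ≠ 0 := by linarith
  have h3 : χ₀ * ω * tStar χ₀ ω n N = (1 / (n - 1)) ^ (1 / n) * (N : ℝ) ^ (-(2 / n)) := by
    unfold tStar
    field_simp
  rw [h3, Real.mul_rpow (by positivity) (by positivity), ← Real.rpow_mul (by positivity),
    ← Real.rpow_mul h2.le, one_div_mul_cancel hn0, Real.rpow_one]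
  have h4 : -(2 / n) * n = -2 := by field_simp
  rw [h4, Real.rpow_neg h2.le, Real.rpow_two, mul_assoc, inv_mul_cancel₀ (by positivity), mul_one]

lemma rate_tStar {χ₀ ω : ℝ} (hn : 1 < n) (hχ : 0 < χ₀) (hω : 0 < ω) (hN : 1 ≤ N) :
    (N : ℝ) ^ 2 * tStar χ₀ ω n N / (1 + (χ₀ * ω * tStar χ₀ ω n N) ^ n * (N : ℝ) ^ 2)
      = 1 / (χ₀ * ω) * ((n - 1) ^ (1 - 1 / n) / n) * (N : ℝ) ^ (2 - 2 / n) := by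
  have h1 : 0 < n - 1 := by linarith
  have h2 : (0 : ℝ) < N := by exact_mod_cast hN
  rw [tStar_rpow_mul hn hχ hω hN, sub_eq_add_neg 2, Real.rpow_add h2, Real.rpow_two,
    Real.rpow_sub h1, Real.rpow_one, tStar, Real.div_rpow zero_le_one h1.le, Real.one_rpow]
  field_simp
  ring

/-- Bernoulli's inequality makes `tStar` the optimal time. -/
lemma rate_le_rate_tStar {χ₀ ω : ℝ} (hn : 1 < n) (hχ : 0 < χ₀) (hω : 0 < ω) (hN : 1 ≤ N)
    {t : ℝ} (ht : 0 < t) :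
    (N : ℝ) ^ 2 * t / (1 + (χ₀ * ω * t) ^ n * (N : ℝ) ^ 2)
      ≤ (N : ℝ) ^ 2 * tStar χ₀ ω n N / (1 + (χ₀ * ω * tStar χ₀ ω n N) ^ n * (N : ℝ) ^ 2) := by
  have h1 : 0 < n - 1 := by linarith
  have h2 : (0 : ℝ) < N := by exact_mod_cast hN
  have hs := tStar_pos hn hχ hω hN
  have hk := tStar_rpow_mul hn hχ hω hN
  set s := tStar χ₀ ω n N
  obtain ⟨u, hu⟩ : ∃ u, u = t / s := ⟨_, rfl⟩
  have hu0 : 0 < u := hu ▸ div_pos ht hs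
  have htu : t = u * s := by rw [hu]; field_simp
  have h3 : (χ₀ * ω * t) ^ n * (N : ℝ) ^ 2 = u ^ n / (n - 1) := by
    rw [htu, mul_left_comm, Real.mul_rpow hu0.le (by positivity), mul_assoc, hk]
    ring
  -- In units of the optimal time, the comparison reads `n u ≤ n - 1 + u ^ n`, which is Bernoulli's
  -- inequality at `1 + (u - 1)`.
  have hb := one_add_mul_self_le_rpow_one_add (s := u - 1) (by linarith) hn.le
  rw [add_sub_cancel] at hb
  have hun : 0 < u ^ n := Real.rpow_pos_of_pos hu0 n
  rw [h3, hk, htu, div_le_div_iff₀ (by positivity) (by positivity)]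
  have h4 : u * (1 + 1 / (n - 1)) ≤ 1 + u ^ n / (n - 1) := by
    have h5 : u * (1 + 1 / (n - 1)) = n * u / (n - 1) := by field_simp; ring
    have h6 : 1 + u ^ n / (n - 1) = (n - 1 + u ^ n) / (n - 1) := by field_simp
    rw [h5, h6]
    gcongr
    linarith
  have h7 := mul_le_mul_of_nonneg_left h4 (by positivity : 0 ≤ (N : ℝ) ^ 2 * s)
  linarith

lemma rate_deriv {t : ℝ} (hκ : 0 < κ) (ht : 0 < t) :
    HasDerivAt (fun t => (N : ℝ) ^ 2 * t / (1 + (κ * t) ^ n * (N : ℝ) ^ 2))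
      ((N : ℝ) ^ 2 * (1 - (n - 1) * ((κ * t) ^ n * (N : ℝ) ^ 2))
        / (1 + (κ * t) ^ n * (N : ℝ) ^ 2) ^ 2) t := by
  have hkt : 0 < κ * t := mul_pos hκ ht
  have h1 : HasDerivAt (fun t => κ * t) κ t := by
    simpa using (hasDerivAt_id t).const_mul κ
  have h2 := ((h1.rpow_const (p := n) (Or.inl hkt.ne')).mul_const ((N : ℝ) ^ 2)).const_add 1
  have h3 : HasDerivAt (fun t => (N : ℝ) ^ 2 * t) ((N : ℝ) ^ 2) t := by
    simpa using (hasDerivAt_id t).const_mul ((N : ℝ) ^ 2)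
  have hpos : 0 < 1 + (κ * t) ^ n * (N : ℝ) ^ 2 := by positivity
  refine (h3.div h2 hpos.ne').congr_deriv ?_
  have h4 : (κ * t) ^ n = (κ * t) ^ (n - 1) * (κ * t) := by
    rw [← Real.rpow_add_one hkt.ne', sub_add_cancel]
  congr 1
  rw [h4]
  ring

lemma rate_deriv_eq_zero_iff {χ₀ ω : ℝ} (hn : 1 < n) (hχ : 0 < χ₀) (hω : 0 < ω) (hN : 1 ≤ N)
    {t : ℝ} (ht : 0 < t) :
    (N : ℝ) ^ 2 * (1 - (n - 1) * ((χ₀ * ω * t) ^ n * (N : ℝ) ^ 2))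
        / (1 + (χ₀ * ω * t) ^ n * (N : ℝ) ^ 2) ^ 2 = 0 ↔ t = tStar χ₀ ω n N := by
  have h1 : 0 < n - 1 := by linarith
  have h2 : (0 : ℝ) < N := by exact_mod_cast hN
  have hs := tStar_pos hn hχ hω hN
  have hk := tStar_rpow_mul hn hχ hω hN
  have hpos : 0 < 1 + (χ₀ * ω * t) ^ n * (N : ℝ) ^ 2 := by positivity
  rw [div_eq_zero_iff, or_iff_left (pow_ne_zero 2 hpos.ne'), mul_eq_zero,
    or_iff_right (pow_ne_zero 2 h2.ne')]
  constructor
  · intro h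
    have h3 : (χ₀ * ω * t) ^ n * (N : ℝ) ^ 2 = 1 / (n - 1) := by
      rw [eq_div_iff h1.ne']
      linarith
    rw [← hk] at h3
    have h4 := mul_right_cancel₀ (pow_ne_zero 2 h2.ne') h3
    rw [Real.rpow_left_inj (by positivity) (by positivity) (by linarith)] at h4
    exact mul_left_cancel₀ (by positivity) h4
  · rintro rfl
    rw [hk]
    field_simp
    ring

lemma linear_rate_lt (hκ : 0 < κ) {t : ℝ} (ht : 0 < t) :
    (N : ℝ) ^ 2 * t / (1 + κ * t * (N : ℝ) ^ 2) < 1 / κ := by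
  rw [div_lt_div_iff₀ (by positivity) hκ]
  linarith

lemma linear_rate_strictMonoOn (hκ : 0 < κ) (hN : 1 ≤ N) :
    StrictMonoOn (fun t => (N : ℝ) ^ 2 * t / (1 + κ * t * (N : ℝ) ^ 2)) (Set.Ioi 0) := by
  intro s (hs : 0 < s) t (ht : 0 < t) hst
  have h2 : (0 : ℝ) < N := by exact_mod_cast hN
  beta_reduce
  rw [div_lt_div_iff₀ (by positivity) (by positivity)]
  have := mul_lt_mul_of_pos_left hst (pow_pos h2 2)
  linarith

lemma tendsto_linear_rate (hκ : 0 < κ) (hN : 1 ≤ N) :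
    Filter.Tendsto (fun t => (N : ℝ) ^ 2 * t / (1 + κ * t * (N : ℝ) ^ 2)) Filter.atTop
      (𝓝 (1 / κ)) := by
  have h2 : (0 : ℝ) < N := by exact_mod_cast hN
  -- Numerator and denominator are divided by `t`.
  have h3 : Filter.Tendsto (fun t : ℝ => (N : ℝ) ^ 2 / (t⁻¹ + κ * (N : ℝ) ^ 2)) Filter.atTop
      (𝓝 ((N : ℝ) ^ 2 / (0 + κ * (N : ℝ) ^ 2))) :=
    tendsto_const_nhds.div (tendsto_inv_atTop_zero.add_const _) (by positivity)
  have h4 : (N : ℝ) ^ 2 / (0 + κ * (N : ℝ) ^ 2) = 1 / κ := by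
    field_simp
    ring
  rw [h4] at h3
  refine h3.congr' ?_
  filter_upwards [Filter.eventually_gt_atTop 0] with t ht
  field_simp

lemma precisionBound_nonneg {χ₀ ω T : ℝ} (hn : 1 ≤ n) (hχ : 0 < χ₀) (hω : 0 < ω) (hT : 0 < T)
    (N : ℕ) : 0 ≤ precisionBound χ₀ ω n T N := by
  have h1 : 0 ≤ n - 1 := by linarith
  unfold precisionBound gFactor
  split_ifs <;> positivity

/-- `precisionBound * T` is the reciprocal of the supremum of the rate, which is attained for `n >
1` and only approached as `t → ∞` for `n = 1`. -/
lemma rate_mul_precisionBound_le {χ₀ ω T t : ℝ} (hn : 1 ≤ n) (hχ : 0 < χ₀) (hω : 0 < ω)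
    (hN : 1 ≤ N) (hT : 0 < T) (ht : 0 < t) :
    (N : ℝ) ^ 2 * t / (1 + (χ₀ * ω * t) ^ n * (N : ℝ) ^ 2) * (precisionBound χ₀ ω n T N * T)
      ≤ 1 := by
  have h2 : (0 : ℝ) < N := by exact_mod_cast hN
  have hB := mul_nonneg (precisionBound_nonneg hn hχ hω hT N) hT.le
  rcases hn.eq_or_lt with rfl | hn
  · have h3 := (linear_rate_lt (N := N) (mul_pos hχ hω) ht).le
    rw [Real.rpow_one]
    refine (mul_le_mul_of_nonneg_right h3 hB).trans_eq ?_
    rw [precisionBound, if_pos rfl]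
    field_simp
  · refine (mul_le_mul_of_nonneg_right (rate_le_rate_tStar hn hχ hω hN ht) hB).trans_eq ?_
    have h1 : 0 < n - 1 := by linarith
    have hn0 : 0 < n := by linarith
    rw [rate_tStar hn hχ hω hN, precisionBound, if_neg hn.ne', gFactor]
    have e1 : (n - 1) ^ (1 - 1 / n) * (n - 1) ^ (-1 + 1 / n) = 1 := by
      rw [← Real.rpow_add h1, show 1 - 1 / n + (-1 + 1 / n) = 0 by ring, Real.rpow_zero]
    have e2 : (N : ℝ) ^ (2 - 2 / n) * (N : ℝ) ^ (-(2 * (n - 1) / n)) = 1 := by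
      rw [← Real.rpow_add h2, show 2 - 2 / n + -(2 * (n - 1) / n) = 0 by field_simp; ring,
        Real.rpow_zero]
    calc _ = ((n - 1) ^ (1 - 1 / n) * (n - 1) ^ (-1 + 1 / n))
          * ((N : ℝ) ^ (2 - 2 / n) * (N : ℝ) ^ (-(2 * (n - 1) / n))) := by field_simp
      _ = 1 := by rw [e1, e2, one_mul]

end PowerLaw

/-! ### The bounds for the individual noise models -/

theorem single_shot {c : ℝ≥0} (hc : 1 ≤ c) (χ : ℝ → ℝ≥0) (N : ℕ) (ρ₀ : Op N) (h : IsDensity ρ₀)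
    (t b : ℝ) (ρ : ℝ → Op N) (V : ℝ) (hρ : ρ = outputState ρ₀ (c * χ t) t)
    (hV : V = variance (ρ b) (Jz N)) :
    IsDensity (ρ b) ∧ (∀ s s', DifferentiableAt ℝ (fun x => ρ x s s') b) ∧
      qfi ρ b ≤ 4 * t ^ 2 * V / (1 + 4 * χ t * V) ∧
      4 * t ^ 2 * V / (1 + 4 * χ t * V) ≤ (N : ℝ) ^ 2 * t ^ 2 / (1 + χ t * (N : ℝ) ^ 2) := by
  subst hρ
  have hd := outputState_isDensity h (c * χ t) t b
  obtain ⟨h0, h1⟩ := variance_nonneg_and_le hd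
  rw [← hV] at h0 h1
  refine ⟨hd, fun s s' => (hasDerivAt_outputState ρ₀ _ t b s s').differentiableAt, ?_,
    singleShotBound_le (χ t).coe_nonneg t h0 h1⟩
  have h2 := qfi_le_singleShotBound h (c * χ t) t b
  rw [← hV] at h2
  exact h2.trans (singleShotBound_anti (χ t).coe_nonneg
    (by exact_mod_cast le_mul_of_one_le_left (zero_le) hc) t h0)

theorem totalQFI_le {χ v : ℝ → ℝ≥0} (hv : ∀ t, χ t ≤ v t) (N : ℕ) (T b : ℝ) (hT : 0 < T) :
    totalQFI N v (Set.Ioi 0) T b ≤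
      ENNReal.ofReal T * ⨆ (t : ℝ) (_ : 0 < t), ENNReal.ofReal (rateBound (fun s => χ s) N t) := by
  refine iSup₂_le fun ρ₀ h => iSup₂_le fun t ht => (ofReal_mul_qfi_le h hv hT ht b).trans ?_
  rw [ENNReal.ofReal_mul hT.le]
  gcongr
  exact le_iSup₂ (f := fun (t : ℝ) (_ : 0 < t) =>
    ENNReal.ofReal (rateBound (fun s => χ s) N t)) t ht

theorem markovian {χ v : ℝ → ℝ≥0} (hv : ∀ t, χ t ≤ v t) {χ₀ ω : ℝ} (hχ : 0 < χ₀) (hω : 0 < ω)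
    (h : ∀ t : ℝ, 0 < t → (χ t : ℝ) = χ₀ * ω * t) (N : ℕ) (hN : 1 ≤ N) :
    StrictMonoOn (rateBound (fun s => χ s) N) (Set.Ioi 0) ∧
    IsLUB (rateBound (fun s => χ s) N '' Set.Ioi 0) (1 / (χ₀ * ω)) ∧
    Filter.Tendsto (rateBound (fun s => χ s) N) Filter.atTop (𝓝 (1 / (χ₀ * ω))) ∧
    ∀ T b : ℝ, 0 < T →
      totalQFI N v (Set.Ioi 0) T b ≤ ENNReal.ofReal (T / (χ₀ * ω)) ∧
      PrecisionAtLeast N v (Set.Ioi 0) T b (precisionBound χ₀ ω 1 T N) := by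
  have hκ : 0 < χ₀ * ω := mul_pos hχ hω
  have hr : ∀ t, 0 < t → rateBound (fun s => χ s) N t
      = (N : ℝ) ^ 2 * t / (1 + χ₀ * ω * t * (N : ℝ) ^ 2) := fun t ht => by
    rw [rateBound, h t ht]
  have hle : ∀ t, 0 < t → rateBound (fun s => χ s) N t ≤ 1 / (χ₀ * ω) := fun t ht => by
    rw [hr t ht]
    exact (linear_rate_lt hκ ht).le
  have htend : Filter.Tendsto (rateBound (fun s => χ s) N) Filter.atTop (𝓝 (1 / (χ₀ * ω))) := by
    refine (tendsto_linear_rate hκ hN).congr' ?_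
    filter_upwards [Filter.eventually_gt_atTop 0] with t ht
    rw [hr t ht]
  refine ⟨(linear_rate_strictMonoOn hκ hN).congr fun t ht => (hr t ht).symm, ⟨?_, ?_⟩, htend,
    fun T b hT => ⟨?_, ?_⟩⟩
  · rintro _ ⟨t, ht, rfl⟩
    exact hle t ht
  · intro u hu
    refine le_of_tendsto htend ?_
    filter_upwards [Filter.eventually_gt_atTop 0] with t ht
    exact hu ⟨t, ht, rfl⟩
  · refine totalQFI_le_ofReal hv hT (fun t ht => ?_) b
    rw [div_eq_mul_one_div]
    exact mul_le_mul_of_nonneg_left (hle t ht) hT.le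
  · refine precisionAtLeast_of_rateBound hv subset_rfl hT
      (precisionBound_nonneg le_rfl hχ hω hT N) (fun t ht => ?_) b
    have h1 := rate_mul_precisionBound_le le_rfl hχ hω hN hT ht
    rwa [Real.rpow_one, ← hr t ht] at h1

theorem colored {χ v : ℝ → ℝ≥0} (hv : ∀ t, χ t ≤ v t) {n χ₀ ω : ℝ} (hn : 1 < n) (hχ : 0 < χ₀)
    (hω : 0 < ω) (h : ∀ t : ℝ, 0 < t → (χ t : ℝ) = χ₀ ^ n * (ω * t) ^ n) (N : ℕ) (hN : 1 ≤ N) :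
    0 < tStar χ₀ ω n N ∧
    (∀ t : ℝ, 0 < t →
      DifferentiableAt ℝ (rateBound (fun s => χ s) N) t ∧
      (deriv (rateBound (fun s => χ s) N) t = 0 ↔ t = tStar χ₀ ω n N)) ∧
    IsMaxOn (rateBound (fun s => χ s) N) (Set.Ioi 0) (tStar χ₀ ω n N) ∧
    rateBound (fun s => χ s) N (tStar χ₀ ω n N) =
      1 / (χ₀ * ω) * ((n - 1) ^ (1 - 1 / n) / n) * (N : ℝ) ^ (2 - 2 / n) ∧
    ∀ T b : ℝ, 0 < T →
      totalQFI N v (Set.Ioi 0) T b ≤ ENNReal.ofReal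
          (T / (χ₀ * ω) * ((n - 1) ^ (1 - 1 / n) / n) * (N : ℝ) ^ (2 - 2 / n)) ∧
      PrecisionAtLeast N v (Set.Ioi 0) T b (precisionBound χ₀ ω n T N) := by
  have hκ : 0 < χ₀ * ω := mul_pos hχ hω
  have hs := tStar_pos hn hχ hω hN
  have hr : ∀ t, 0 < t → rateBound (fun s => χ s) N t
      = (N : ℝ) ^ 2 * t / (1 + (χ₀ * ω * t) ^ n * (N : ℝ) ^ 2) := fun t ht => by
    rw [rateBound, h t ht, ← Real.mul_rpow hχ.le (by positivity), mul_assoc χ₀]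
  have hmax : ∀ t, 0 < t →
      rateBound (fun s => χ s) N t ≤ rateBound (fun s => χ s) N (tStar χ₀ ω n N) := fun t ht => by
    rw [hr t ht, hr _ hs]
    exact rate_le_rate_tStar hn hχ hω hN ht
  have hval : rateBound (fun s => χ s) N (tStar χ₀ ω n N) =
      1 / (χ₀ * ω) * ((n - 1) ^ (1 - 1 / n) / n) * (N : ℝ) ^ (2 - 2 / n) := by
    rw [hr _ hs, rate_tStar hn hχ hω hN]
  refine ⟨hs, fun t ht => ?_, fun t ht => hmax t ht, hval, fun T b hT => ⟨?_, ?_⟩⟩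
  · have hd := (rate_deriv (n := n) (N := N) hκ ht).congr_of_eventuallyEq
      (f₁ := rateBound (fun s => χ s) N)
      (by filter_upwards [lt_mem_nhds ht] with x hx using hr x hx)
    refine ⟨hd.differentiableAt, ?_⟩
    rw [hd.deriv]
    exact rate_deriv_eq_zero_iff hn hχ hω hN ht
  · refine totalQFI_le_ofReal hv hT (fun t ht => ?_) b
    refine (mul_le_mul_of_nonneg_left (hmax t ht) hT.le).trans_eq ?_
    rw [hval]
    ring
  · refine precisionAtLeast_of_rateBound hv subset_rfl hT
      (precisionBound_nonneg hn.le hχ hω hT N) (fun t ht => ?_) b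
    have h1 := rate_mul_precisionBound_le hn.le hχ hω hN hT ht
    rwa [← hr t ht] at h1

/-- The time `τ` is chosen so that `χ` exceeds `1 - ε` times the power law on `(0, τ]`; this
involves neither `N` nor `T`. The rate then exceeds that of the exact power law by at most the
factor `1 / (1 - ε)`. -/
theorem short_time {χ v : ℝ → ℝ≥0} (hv : ∀ t, χ t ≤ v t) {n χ₀ ω : ℝ} (hn : 1 ≤ n) (hχ : 0 < χ₀)
    (hω : 0 < ω)
    (h : Filter.Tendsto (fun t : ℝ => (χ t : ℝ) / (χ₀ ^ n * (ω * t) ^ n)) (𝓝[>] 0) (𝓝 1))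
    {ε : ℝ} (hε0 : 0 < ε) (hε1 : ε < 1) : ∃ τ : ℝ, 0 < τ ∧
      ∀ (N : ℕ), 1 ≤ N → ∀ T b : ℝ, 0 < T →
        PrecisionAtLeast N v (Set.Ioc 0 τ) T b ((1 - ε) * precisionBound χ₀ ω n T N) := by
  obtain ⟨τ, hτ, hsub⟩ := mem_nhdsGT_iff_exists_Ioc_subset.mp
    (h (lt_mem_nhds (by linarith : 1 - ε < 1)))
  refine ⟨τ, hτ, fun N hN T b hT => ?_⟩
  have hε : 0 < 1 - ε := by linarith
  have hB := precisionBound_nonneg hn hχ hω hT N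
  refine precisionAtLeast_of_rateBound hv (fun t ht => ht.1) hT (mul_nonneg hε.le hB)
    (fun t ht => ?_) b
  have ht0 : 0 < t := ht.1
  have h1 : 1 - ε < (χ t : ℝ) / (χ₀ ^ n * (ω * t) ^ n) := hsub ht
  rw [lt_div_iff₀ (by positivity), ← Real.mul_rpow hχ.le (by positivity), ← mul_assoc χ₀] at h1
  refine le_trans ?_ (rate_mul_precisionBound_le hn hχ hω hN hT ht0)
  rw [mul_assoc (1 - ε), ← mul_assoc _ (1 - ε)]
  refine mul_le_mul_of_nonneg_right ?_ (mul_nonneg hB hT.le)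
  rw [rateBound, div_mul_eq_mul_div, div_le_div_iff₀ (by positivity) (by positivity)]
  -- The constant term `1` also absorbs the factor, since `1 - ε ≤ 1`.
  have h2 : (1 - ε) * (1 + (χ₀ * ω * t) ^ n * (N : ℝ) ^ 2) ≤ 1 + χ t * (N : ℝ) ^ 2 := by
    have := mul_le_mul_of_nonneg_right h1.le (sq_nonneg (N : ℝ))
    linarith
  have h3 := mul_le_mul_of_nonneg_left h2 (by positivity : 0 ≤ (N : ℝ) ^ 2 * t)
  linarith

end CollectiveDephasing

/-- The phase variance is `c * χ t`, where `c = 1` is the normalization in which `χ` is the variance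
of the accumulated phase and `c = 2` the one in which coherences decay as `exp (-χ (m - m')²)`. -/
theorem mainTheorem2 (c : ℝ≥0) (hc : c = 1 ∨ c = 2) (χ : ℝ → ℝ≥0) :
    -- single-shot bounds, for every decay function and every input state
    (∀ (N : ℕ) (ρ₀ : CollectiveDephasing.Op N), CollectiveDephasing.IsDensity ρ₀ →
      ∀ (t b : ℝ), 0 ≤ t → ∀ (ρ : ℝ → CollectiveDephasing.Op N) (V : ℝ),
        ρ = CollectiveDephasing.outputState ρ₀ (c * χ t) t →
        V = CollectiveDephasing.variance (ρ b) (CollectiveDephasing.Jz N) →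
        CollectiveDephasing.IsDensity (ρ b) ∧
        (∀ s s', DifferentiableAt ℝ (fun x => ρ x s s') b) ∧
        CollectiveDephasing.qfi ρ b ≤ 4 * t ^ 2 * V / (1 + 4 * χ t * V) ∧
        4 * t ^ 2 * V / (1 + 4 * χ t * V) ≤ (N : ℝ) ^ 2 * t ^ 2 / (1 + χ t * (N : ℝ) ^ 2)) ∧
    -- total quantum Fisher information at fixed total time
    (∀ (N : ℕ) (T b : ℝ), 0 < T →
      CollectiveDephasing.totalQFI N (fun t => c * χ t) (Set.Ioi 0) T b ≤
        ENNReal.ofReal T * ⨆ (t : ℝ) (_ : 0 < t),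
          ENNReal.ofReal (CollectiveDephasing.rateBound (fun s => χ s) N t)) ∧
    -- Markovian noise, exact linear law
    (∀ (χ₀ ω : ℝ), 0 < χ₀ → 0 < ω → (∀ t : ℝ, 0 < t → (χ t : ℝ) = χ₀ * ω * t) →
      ∀ (N : ℕ), 1 ≤ N →
        StrictMonoOn (CollectiveDephasing.rateBound (fun s => χ s) N) (Set.Ioi 0) ∧
        IsLUB (CollectiveDephasing.rateBound (fun s => χ s) N '' Set.Ioi 0) (1 / (χ₀ * ω)) ∧
        Filter.Tendsto (CollectiveDephasing.rateBound (fun s => χ s) N) Filter.atTop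
          (𝓝 (1 / (χ₀ * ω))) ∧
        ∀ T b : ℝ, 0 < T →
          CollectiveDephasing.totalQFI N (fun t => c * χ t) (Set.Ioi 0) T b ≤
            ENNReal.ofReal (T / (χ₀ * ω)) ∧
          CollectiveDephasing.PrecisionAtLeast N (fun t => c * χ t) (Set.Ioi 0) T b
            (CollectiveDephasing.precisionBound χ₀ ω 1 T N)) ∧
    -- colored noise, exact power law
    (∀ (n χ₀ ω : ℝ), 1 < n → 0 < χ₀ → 0 < ω →
      (∀ t : ℝ, 0 < t → (χ t : ℝ) = χ₀ ^ n * (ω * t) ^ n) →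
      ∀ (N : ℕ), 1 ≤ N →
        0 < CollectiveDephasing.tStar χ₀ ω n N ∧
        (∀ t : ℝ, 0 < t →
          DifferentiableAt ℝ (CollectiveDephasing.rateBound (fun s => χ s) N) t ∧
          (deriv (CollectiveDephasing.rateBound (fun s => χ s) N) t = 0 ↔
            t = CollectiveDephasing.tStar χ₀ ω n N)) ∧
        IsMaxOn (CollectiveDephasing.rateBound (fun s => χ s) N) (Set.Ioi 0)
          (CollectiveDephasing.tStar χ₀ ω n N) ∧
        CollectiveDephasing.rateBound (fun s => χ s) N (CollectiveDephasing.tStar χ₀ ω n N) =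
          1 / (χ₀ * ω) * ((n - 1) ^ (1 - 1 / n) / n) * (N : ℝ) ^ (2 - 2 / n) ∧
        ∀ T b : ℝ, 0 < T →
          CollectiveDephasing.totalQFI N (fun t => c * χ t) (Set.Ioi 0) T b ≤
            ENNReal.ofReal
              (T / (χ₀ * ω) * ((n - 1) ^ (1 - 1 / n) / n) * (N : ℝ) ^ (2 - 2 / n)) ∧
          CollectiveDephasing.PrecisionAtLeast N (fun t => c * χ t) (Set.Ioi 0) T b
            (CollectiveDephasing.precisionBound χ₀ ω n T N)) ∧
    -- power law valid only at short times, short interrogation times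
    (∀ (n χ₀ ω : ℝ), 1 ≤ n → 0 < χ₀ → 0 < ω →
      Filter.Tendsto (fun t : ℝ => (χ t : ℝ) / (χ₀ ^ n * (ω * t) ^ n)) (𝓝[>] 0) (𝓝 1) →
      ∀ ε : ℝ, 0 < ε → ε < 1 → ∃ τ : ℝ, 0 < τ ∧
        ∀ (N : ℕ), 1 ≤ N → ∀ T b : ℝ, 0 < T →
          CollectiveDephasing.PrecisionAtLeast N (fun t => c * χ t) (Set.Ioc 0 τ) T b
            ((1 - ε) * CollectiveDephasing.precisionBound χ₀ ω n T N)) := by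
  have hc1 : 1 ≤ c := by rcases hc with rfl | rfl <;> norm_num
  have hv : ∀ t, χ t ≤ c * χ t := fun t => le_mul_of_one_le_left zero_le hc1
  exact ⟨fun N ρ₀ h t b _ ρ V hρ hV =>
      CollectiveDephasing.single_shot hc1 χ N ρ₀ h t b ρ V hρ hV,
    fun N T b hT => CollectiveDephasing.totalQFI_le hv N T b hT,
    fun _ _ hχ hω h N hN => CollectiveDephasing.markovian hv hχ hω h N hN,
    fun _ _ _ hn hχ hω h N hN => CollectiveDephasing.colored hv hn hχ hω h N hN,
    fun _ _ _ hn hχ hω h _ hε0 hε1 =>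
      CollectiveDephasing.short_time hv hn hχ hω h hε0 hε1⟩
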